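/- Let $a,b>0$, $a\neq b$, let $\mathcal{E}$ be the ellipse $(x/a)^2+(y/b)^2=1$ in $\mathbb{R}^2=\mathbb{C}$, and let $\mathcal{E}_c$ be an arbitrary ellipse (possibly a circle) contained in the open region bounded by $\mathcal{E}$, such that there is a triangle inscribed in $\mathcal{E}$ whose three side lines are tangent to $\mathcal{E}_c$. Let $\mathcal{T}$ be the family of all such (Poncelet) triangles. For a point $P$, the isogonal conjugate $P^\dagger$ of $P$ with respect to a triangle of which $P$ is not a vertex is the point of concurrence (if there is one in the plane) of the reflections of the three cevians of $P$ in the angle bisectors at the corresponding vertices. Let $\mathcal{L}^\dagger$ be the set of all points $P^\dagger$ with respect to triangles of $\mathcal{T}$ that do not have $P$ as a vertex. Put $\mathcal{A}^{-1}(x,y)=x/a+iy/b$. Then $\mathcal{A}^{-1}(\mathcal{E}_c)$ is an ellipse with two (possibly equal) foci $f=f_x+if_y$ and $g=g_x+ig_y$, and for every $P\in\mathcal{E}$, with $u=\mathcal{A}^{-1}(P)$, there is a triangle $PBC\in\mathcal{T}$ with apex $P$, and there is a line $L$ such that, for every such triangle: * if $\operatorname{Im}\big((u-f)(u-g)\big)\neq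 0$, then $L$ meets the base line $BC$ in exactly one point $Q$, and $\mathcal{L}^\dagger=L\setminus\{Q\}$; * if $\operatorname{Im}\big((u-f)(u-g)\big)=0$, then $L$ is parallel to and distinct from the base line $BC$ (that is, $Q$ is at infinity), and $\mathcal{L}^\dagger=L$. Explicitly, let $P=\left(a\frac{1-t^2}{1+t^2},\,b\frac{2t}{1+t^2}\right)$ with $t\in\mathbb{R}$, and put $G=g_x^2+g_y^2-1$. Then the above holds with $L=\{(x,y): F(x,y)=0\}$, which is a line, where $$\begin{aligned}F(x,y)=\;&a^5b\big((t^2+1)(f_x^2+f_y^2)G-2f_x(3(t^2+1)g_x+t^2-1)+2f_y(t^2g_y+g_y+2t)-t^2(g_x(g_x+2)+g_y^2-3)+4tg_y-g_x^2+2g_x-g_y^2+3\big)\\ &-2a^3b^3\big((t^2+1)(f_x^2+f_y^2)G-2f_x(t^2(g_x+1)+g_x-1)-2f_y(t^2g_y+g_y-2t)-t^2(g_x(g_x+2)+g_y^2+5)+4tg_y-(g_x-2)g_x-g_y^2-5\big)\\ &+2ay(a^2-b^2)\big(2t(a^2(-f_xg_x+f_yg_y+1)+b^2(f_xg_x-f_yg_y+3))+t^2(a^2-b^2)(f_yg_x+f_xg_y+f_y+g_y)-(a^2-b^2)(f_y(g_x-1)+(f_x-1)g_y)\big)\\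 &-2bx(a^2-b^2)\big(a^2(-t^2(f_yg_y+g_x+3)+f_x(t^2(g_x-1)+2tg_y-g_x-1)+2tf_yg_x+f_yg_y-g_x+3)\\ &\qquad+b^2(t^2(-f_xg_x+f_yg_y+f_x+g_x-1)-2t(f_yg_x+f_xg_y)+f_xg_x-f_yg_y+f_x+g_x+1)\big)\\ &+ab^5\big((t^2+1)(f_x^2+f_y^2)G+2f_x(t^2(g_x-1)+g_x+1)+f_y(4t-6(t^2+1)g_y)-t^2(g_x(g_x+2)+g_y^2-3)+4tg_y-g_x^2+2g_x-g_y^2+3\big).\end{aligned}$$ With $$\Delta=(a^2-b^2)\big(-2t^3(f_x+g_x+2)+(t^2+1)f_y(t^2(g_x+1)+g_x-1)+(t^2+1)g_y(t^2(f_x+1)+f_x-1)-2t(f_x+g_x-2)\big),$$ the first case holds if $\Delta\neq0$, with $Q=\left(\frac{Q_x}{\Delta},\frac{Q_y}{2\Delta}\right)$, and the second case holds if $\Delta=0$. Here $$\begin{aligned}Q_x=\;&a^3\big(t(t^2+1)f_y^2G-(t^2-1)f_y(t^2(g_x+1)+g_x-1)+t(t^2+1)(f_x^2-1)g_y^2-(t^2-1)g_y(t^2(f_x+1)+f_x-1)\\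 &\quad+t(-2f_x(2(t^2+1)g_x+t^2-1)+(t^2+1)f_x^2(g_x^2-1)-g_x(t^2(g_x+2)+g_x-2)+t^2+1)\big)\\ &-ab^2\big(t(t^2+1)f_y^2G+t(tg_y(t^2(f_x+1)+6)+(t^2+1)(f_x^2-1)g_y^2+(t^2+1)(f_x^2-1)g_x^2-t^2(f_x(f_x+2)+3)-2(t^2-1)g_x)\\ &\quad+f_y((t^4-1)g_x-4(t^3+t)g_y+t^4+6t^2+1)-f_xg_y-t((f_x-2)f_x+3)+g_y\big),\\ Q_y=\;&b^3\big((t^4-1)(f_x^2+f_y^2)G-4tf_x(t^2g_y+g_y-2t)-4f_y((t^4-1)g_y+t^3(g_x-1)+tg_x+t)-t^4G+4t^3g_y+8t^2g_x-4tg_y+G\big)\\ &-a^2b\big((t^4-1)(f_x^2+f_y^2)G+4tf_y(t^2(g_x+1)+g_x-1)-4f_x((t^4-1)g_x-(t^3+t)g_y+t^4+1)\\ &\quad-t^4(g_x(g_x+4)+g_y^2+3)+4t^3g_y-4tg_y+(g_x-4)g_x+g_y^2+3\big).\end{aligned}$$ -/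

import Mathlib

noncomputable section

namespace Poncelet

/-- The affine map `(x, y) ↦ (a x, b y)` of the plane `ℂ = ℝ²`. -/
def scaleMap (a b : ℝ) (z : ℂ) : ℂ := ⟨a * z.re, b * z.im⟩

/-- The inverse `(x, y) ↦ (x / a, y / b)` of `scaleMap a b` (for `a, b ≠ 0`). -/
def unscaleMap (a b : ℝ) (z : ℂ) : ℂ := ⟨z.re / a, z.im / b⟩

/-- The ellipse `(x/a)² + (y/b)² = 1`. -/
def axisEllipse (a b : ℝ) : Set ℂ := {z | (z.re / a) ^ 2 + (z.im / b) ^ 2 = 1}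

/-- The open region bounded by `axisEllipse a b`. -/
def axisEllipseInterior (a b : ℝ) : Set ℂ := {z | (z.re / a) ^ 2 + (z.im / b) ^ 2 < 1}

/-- An arbitrary ellipse (circles included): an image of the unit circle under an invertible
affine map of the plane. -/
def IsEllipse (K : Set ℂ) : Prop := ∃ T : ℂ ≃ᵃ[ℝ] ℂ, K = T '' Metric.sphere (0 : ℂ) 1

/-- `K` is the ellipse with foci `f`, `g`, for some major axis length `2 m` (a circle if `f = g`). -/
def AreFoci (f g : ℂ) (K : Set ℂ) : Prop :=
  ∃ m : ℝ, dist f g < 2 * m ∧ K = {z | dist z f + dist z g = 2 * m}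

/-- The line `AB` is tangent to the ellipse `K`: it meets `K` in exactly one point. -/
def SideTangent (K : Set ℂ) (A B : ℂ) : Prop :=
  ∃! X : ℂ, X ∈ line[ℝ, A, B] ∧ X ∈ K

/-- `ABC` is a nondegenerate triangle inscribed in `axisEllipse a b` and circumscribed
about `K`. -/
structure IsPonceletTriangle (a b : ℝ) (K : Set ℂ) (A B C : ℂ) : Prop where
  nondegenerate : AffineIndependent ℝ ![A, B, C]
  mem_A : A ∈ axisEllipse a b
  mem_B : B ∈ axisEllipse a b
  mem_C : C ∈ axisEllipse a b
  tangent_AB : SideTangent K A B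
  tangent_BC : SideTangent K B C
  tangent_CA : SideTangent K C A

/-- The internal bisector of the angle `BAC`. -/
def bisector (A B C : ℂ) : AffineSubspace ℝ ℂ :=
  line[ℝ, A, A + (‖B - A‖⁻¹ • (B - A) + ‖C - A‖⁻¹ • (C - A))]

instance (A B C : ℂ) : Nonempty (bisector A B C) :=
  ⟨⟨A, left_mem_affineSpan_pair ℝ _ _⟩⟩

/-- The cevian `AP`, reflected in the internal bisector of the angle `BAC`. -/
def reflectedCevian (A B C P : ℂ) : Set ℂ :=
  EuclideanGeometry.reflection (bisector A B C) '' (line[ℝ, A, P] : Set ℂ)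

/-- `R` is the isogonal conjugate of `P` with respect to the triangle `ABC`: `P` is not a vertex
(so that its three cevians exist) and the three reflected cevians concur at `R`. For a
nondegenerate triangle they have at most one common point, and none if `P` lies on the
circumcircle. -/
structure IsIsogonalConjugate (A B C P R : ℂ) : Prop where
  ne_A : P ≠ A
  ne_B : P ≠ B
  ne_C : P ≠ C
  mem_A : R ∈ reflectedCevian A B C P
  mem_B : R ∈ reflectedCevian B C A P
  mem_C : R ∈ reflectedCevian C A B P

/-- The locus of the isogonal conjugate of the fixed point `P` over the Poncelet family. -/
def isogonalLocus (a b : ℝ) (K : Set ℂ) (P : ℂ) : Set ℂ :=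
  {R | ∃ A B C : ℂ, IsPonceletTriangle a b K A B C ∧ IsIsogonalConjugate A B C P R}

/-- `L` is a line in the plane. -/
def IsLine (L : Set ℂ) : Prop := ∃ p q : ℂ, p ≠ q ∧ L = (line[ℝ, p, q] : Set ℂ)

/-- The point of `axisEllipse a b` with rational parameter `t`. -/
def ellipsePoint (a b t : ℝ) : ℂ :=
  ⟨a * ((1 - t ^ 2) / (1 + t ^ 2)), b * (2 * t / (1 + t ^ 2))⟩

/-- The affine-linear form in `(x, y)` whose zeros are the line-locus for the point
`(a(1-t²)/(1+t²), 2bt/(1+t²))`; here `f = fx + i fy`, `g = gx + i gy`. -/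
def lineForm (a b fx fy gx gy t x y : ℝ) : ℝ :=
    a^5 * b * ((t^2 + 1) * fx^2 * (gx^2 + gy^2 - 1) + (t^2 + 1) * fy^2 * (gx^2 + gy^2 - 1) - 2
      * fx * (3 * (t^2 + 1) * gx + t^2 - 1) + 2 * fy * (t^2 * gy + gy + 2 * t) + t^2 * (-(gx *
      (gx + 2) + gy^2 - 3)) + 4 * t * gy - gx^2 + 2 * gx - gy^2 + 3)
    - 2 * a^3 * b^3 * ((t^2 + 1) * fx^2 * (gx^2 + gy^2 - 1) + (t^2 + 1) * fy^2 * (gx^2 + gy^2 -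
      1) - 2 * fx * (t^2 * (gx + 1) + gx - 1) - 2 * fy * (t^2 * gy + gy - 2 * t) + t^2 * (-(gx
      * (gx + 2) + gy^2 + 5)) + 4 * t * gy - (gx - 2) * gx - gy^2 - 5)
    + 2 * a * y * (a - b) * (a + b) * (2 * t * (a^2 * (-fx * gx + fy * gy + 1) + b^2 * (fx * gx -
      fy * gy + 3)) + t^2 * (a - b) * (a + b) * (fy * gx + fx * gy + fy + gy) - (a - b) * (a +
      b) * (fy * (gx - 1) + (fx - 1) * gy))
    - 2 * b * x * (a - b) * (a + b) * (a^2 * (t^2 * (-(fy * gy + gx + 3)) + fx * (t^2 * (gx - 1)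
      + 2 * t * gy - gx - 1) + 2 * t * fy * gx + fy * gy - gx + 3) + b^2 * (t^2 * (fx * (-gx) +
      fy * gy + fx + gx - 1) - 2 * t * (fy * gx + fx * gy) + fx * gx - fy * gy + fx + gx + 1))
    + a * b^5 * ((t^2 + 1) * fx^2 * (gx^2 + gy^2 - 1) + (t^2 + 1) * fy^2 * (gx^2 + gy^2 - 1) + 2
      * fx * (t^2 * (gx - 1) + gx + 1) + fy * (4 * t - 6 * (t^2 + 1) * gy) + t^2 * (-(gx * (gx
      + 2) + gy^2 - 3)) + 4 * t * gy - gx^2 + 2 * gx - gy^2 + 3)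

/-- The common denominator of the coordinates of the removed point. -/
def removedDen (a b fx fy gx gy t : ℝ) : ℝ :=
    (a - b) * (a + b) * (-2 * t^3 * (fx + gx + 2) + (t^2 + 1) * fy * (t^2 * (gx + 1) + gx - 1)
      + (t^2 + 1) * gy * (t^2 * (fx + 1) + fx - 1) - 2 * t * (fx + gx - 2))

def removedNumX (a b fx fy gx gy t : ℝ) : ℝ :=
    a^3 * (t * (t^2 + 1) * fy^2 * (gx^2 + gy^2 - 1) - (t^2 - 1) * fy * (t^2 * (gx + 1) + gx -
      1) + t * (t^2 + 1) * (fx^2 - 1) * gy^2 - (t^2 - 1) * gy * (t^2 * (fx + 1) + fx - 1) + t *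
      (-2 * fx * (2 * (t^2 + 1) * gx + t^2 - 1) + (t^2 + 1) * fx^2 * (gx^2 - 1) - gx * (t^2 *
      (gx + 2) + gx - 2) + t^2 + 1))
    - a * b^2 * (t * (t^2 + 1) * fy^2 * (gx^2 + gy^2 - 1) + t * (t * gy * (t^2 * (fx + 1) + 6) +
      (t^2 + 1) * (fx^2 - 1) * gy^2 + (t^2 + 1) * (fx^2 - 1) * gx^2 + t^2 * (-(fx * (fx + 2) +
      3)) - 2 * (t^2 - 1) * gx) + fy * ((t^4 - 1) * gx - 4 * (t^3 + t) * gy + t^4 + 6 * t^2 +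
      1) - fx * gy - t * ((fx - 2) * fx + 3) + gy)

def removedNumY (a b fx fy gx gy t : ℝ) : ℝ :=
    b^3 * ((t^4 - 1) * fx^2 * (gx^2 + gy^2 - 1) + (t^4 - 1) * fy^2 * (gx^2 + gy^2 - 1) - 4 * t
      * fx * (t^2 * gy + gy - 2 * t) - 4 * fy * ((t^4 - 1) * gy + t^3 * (gx - 1) + t * gx + t)
      + t^4 * (-(gx^2 + gy^2 - 1)) + 4 * t^3 * gy + 8 * t^2 * gx - 4 * t * gy + gx^2 + gy^2 -
      1)
    - a^2 * b * ((t^4 - 1) * fx^2 * (gx^2 + gy^2 - 1) + (t^4 - 1) * fy^2 * (gx^2 + gy^2 - 1) + 4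
      * t * fy * (t^2 * (gx + 1) + gx - 1) - 4 * fx * ((t^4 - 1) * gx - (t^3 + t) * gy + t^4 +
      1) + t^4 * (-(gx * (gx + 4) + gy^2 + 3)) + 4 * t^3 * gy - 4 * t * gy + (gx - 4) * gx +
      gy^2 + 3)

/-- The removed point (meaningful when `removedDen` does not vanish). -/
def removedPoint (a b fx fy gx gy t : ℝ) : ℂ :=
  ⟨removedNumX a b fx fy gx gy t / removedDen a b fx fy gx gy t,
    removedNumY a b fx fy gx gy t / 2 / removedDen a b fx fy gx gy t⟩

/-- The line-locus for the point with parameter `t`, as a set. -/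
def lineLocus (a b fx fy gx gy t : ℝ) : Set ℂ :=
  {z | lineForm a b fx fy gx gy t z.re z.im = 0}

end Poncelet

end

noncomputable section

namespace Poncelet

open ComplexConjugate

/-! Put p = (a+b)/2 and q = (a-b)/2. The outer ellipse is the image of the unit circle under z ↦ p z
+ q z̄, and in the unit circle picture the foci f, g of the inner ellipse lie in the open disc.
Triangles inscribed in the circle with sides tangent to the inner ellipse are exactly the solution
sets of z(z-f)(z-g) = l(1-f̄z)(1-ḡz) with |l| = 1 (`isPonceletTriangle_iff_blaschkeTriple`). So the
family is parametrized by l, the symmetric functions of the vertices are affine in l, and each point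
of the circle is a vertex for exactly one l.

The isogonality condition at a vertex zᵢ reduces to a quadratic in zᵢ whose coefficients depend only
on these symmetric functions (`cevianForm_eq`). Three distinct zeros kill all coefficients, which
leaves a linear system for X and X̄ (`isIsogonalConjugate_aff_iff`). Its solution `locusPoint` is a
Möbius function of l with denominator a multiple of u l - 1. The pole l = ū lies on the unit circle,
so the circle without it is mapped onto a line (`locusLine_eq`, with `mobius_sum_ne_zero` for
nondegeneracy). At the pole, P lies on the circumcircle unless it is a vertex.

The parameter l₀ of the triangle PBC must be omitted. A locus point lies on BC only for l = l₀
(`locusPoint_mem_line_iff`). With w = (u-f)(u-g) one has u l₀ = w / w̄, so l₀ is the pole exactly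
when Im w = 0; then nothing more is removed and the line misses BC. The explicit polynomials are
real and imaginary parts of the Möbius data at the rational point of the circle. -/

/-! ### Blaschke triples and tangent chords of the unit circle. -/

/-- `z₁, z₂, z₃` are the solutions of `z (z - f) (z - g) = l (1 - f̄ z) (1 - ḡ z)`, with
multiplicity. -/
structure BlaschkeTriple (f g l z₁ z₂ z₃ : ℂ) : Prop where
  sum : z₁ + z₂ + z₃ = f + g + l * (conj f * conj g)
  sum_mul : z₁ * z₂ + z₂ * z₃ + z₃ * z₁ = f * g + l * (conj f + conj g)
  prod : z₁ * z₂ * z₃ = l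

/-- The chord of the unit circle through `z` and `w` is tangent to the ellipse with foci `f`, `g`
and squared minor axis `k`. -/
def ChordTangent (f g k z w : ℂ) : Prop :=
  (f + z * w * conj f - z - w) * (g + z * w * conj g - z - w) = k * (z * w)

lemma BlaschkeTriple.rotate {f g l z₁ z₂ z₃ : ℂ} (h : BlaschkeTriple f g l z₁ z₂ z₃) :
    BlaschkeTriple f g l z₂ z₃ z₁ :=
  ⟨by linear_combination h.sum, by linear_combination h.sum_mul, by linear_combination h.prod⟩

/-- With `l` replaced by the product, the first two relations are linear in `z₃`; eliminating `z₃`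
leaves the tangency condition. -/
lemma BlaschkeTriple.chordTangent {f g l z₁ z₂ z₃ : ℂ} (h : BlaschkeTriple f g l z₁ z₂ z₃) :
    ChordTangent f g ((1 - f * conj f) * (1 - g * conj g)) z₁ z₂ := by
  obtain ⟨h1, h2, h3⟩ := h
  subst h3
  unfold ChordTangent
  linear_combination (z₁ + z₂ - z₁ * z₂ * (conj f + conj g)) * h1 +
    (z₁ * z₂ * (conj f * conj g) - 1) * h2

lemma quadratic_coeffs_eq_zero {c₀ c₁ c₂ x y z : ℂ} (hxy : x ≠ y) (hyz : y ≠ z) (hzx : z ≠ x)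
    (hx : c₂ * x ^ 2 + c₁ * x + c₀ = 0) (hy : c₂ * y ^ 2 + c₁ * y + c₀ = 0)
    (hz : c₂ * z ^ 2 + c₁ * z + c₀ = 0) : c₀ = 0 ∧ c₁ = 0 ∧ c₂ = 0 := by
  have e1 : c₂ * (x + y) + c₁ = 0 := by
    apply mul_left_cancel₀ (sub_ne_zero.2 hxy); linear_combination hx - hy
  have e2 : c₂ * (y + z) + c₁ = 0 := by
    apply mul_left_cancel₀ (sub_ne_zero.2 hyz); linear_combination hy - hz
  have e3 : c₂ = 0 := by
    apply mul_left_cancel₀ (sub_ne_zero.2 hzx); linear_combination e2 - e1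
  subst e3
  have e4 : c₁ = 0 := by linear_combination e1
  subst e4
  exact ⟨by linear_combination hx, rfl, rfl⟩

lemma ChordTangent.symm {f g k z w : ℂ} (h : ChordTangent f g k z w) :
    ChordTangent f g k w z := by
  unfold ChordTangent at *
  linear_combination h

/-- For fixed `z₁`, tangency is a quadratic equation in the other endpoint, with roots `z₂` and
`z₃`. Its leading and constant coefficients do not involve `k`, so the product of the roots gives a
relation free of `k`. -/
lemma ChordTangent.mul_prod {f g k z₁ z₂ z₃ : ℂ} (h2 : ChordTangent f g k z₁ z₂)
    (h3 : ChordTangent f g k z₁ z₃) (hne : z₂ ≠ z₃) :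
    z₁ * (z₁ - f) * (z₁ - g) = z₁ * z₂ * z₃ * ((1 - conj f * z₁) * (1 - conj g * z₁)) := by
  unfold ChordTangent at *
  have e : (1 - conj f * z₁) * (1 - conj g * z₁) * (z₂ + z₃) =
      (f - z₁) * (1 - conj g * z₁) + (g - z₁) * (1 - conj f * z₁) + k * z₁ := by
    apply mul_left_cancel₀ (sub_ne_zero.2 hne)
    linear_combination h2 - h3
  linear_combination z₁ * h2 - z₁ * z₂ * e

/-- The cubic of the Blaschke equation and the cubic with roots `z₁, z₂, z₃` are both monic up to a
common treatment of the constant term `l`: their difference is a quadratic without constant term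
that has three distinct roots, hence is zero. One side then determines `k`. -/
lemma blaschkeTriple_of_chordTangent {f g k z₁ z₂ z₃ : ℂ} (h12 : z₁ ≠ z₂) (h23 : z₂ ≠ z₃)
    (h31 : z₃ ≠ z₁) (n1 : z₁ ≠ 0) (n2 : z₂ ≠ 0) (t12 : ChordTangent f g k z₁ z₂)
    (t23 : ChordTangent f g k z₂ z₃) (t31 : ChordTangent f g k z₃ z₁) :
    BlaschkeTriple f g (z₁ * z₂ * z₃) z₁ z₂ z₃ ∧
      k = (1 - f * conj f) * (1 - g * conj g) := by
  have e1 := t12.mul_prod t31.symm h23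
  have e2 := t23.mul_prod t12.symm h31
  have e3 := t31.mul_prod t23.symm h12
  obtain ⟨c0, c1, c2⟩ := quadratic_coeffs_eq_zero (x := z₁) (y := z₂) (z := z₃)
    (c₂ := (z₁ + z₂ + z₃) - (f + g + z₁ * z₂ * z₃ * (conj f * conj g)))
    (c₁ := (f * g + z₁ * z₂ * z₃ * (conj f + conj g)) - (z₁ * z₂ + z₂ * z₃ + z₃ * z₁))
    (c₀ := 0) h12 h23 h31 (by linear_combination e1) (by linear_combination e2)
    (by linear_combination e3)
  have hB : BlaschkeTriple f g (z₁ * z₂ * z₃) z₁ z₂ z₃ :=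
    ⟨by linear_combination c2, by linear_combination -c1, rfl⟩
  refine ⟨hB, mul_right_cancel₀ (mul_ne_zero n1 n2) ?_⟩
  have := hB.chordTangent
  unfold ChordTangent at *
  rw [← t12, this]

/-! ### Solutions of the Blaschke equation lie on the circle and are distinct. -/

lemma mul_conj_eq_one {z : ℂ} (h : ‖z‖ = 1) : z * conj z = 1 := by
  rw [Complex.mul_conj, Complex.normSq_eq_norm_sq, h]; simp

lemma normSq_lt_one {z : ℂ} (h : ‖z‖ < 1) : Complex.normSq z < 1 := by
  rw [Complex.normSq_eq_norm_sq]; nlinarith [norm_nonneg z]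

lemma normSq_one_sub_conj_mul (f z : ℂ) :
    Complex.normSq (1 - conj f * z) - Complex.normSq (z - f) =
      (1 - Complex.normSq f) * (1 - Complex.normSq z) := by
  simp only [Complex.normSq_apply, Complex.sub_re, Complex.sub_im, Complex.mul_re, Complex.mul_im,
    Complex.conj_re, Complex.conj_im, Complex.one_re, Complex.one_im]
  ring

lemma one_sub_conj_mul_ne_zero {f z : ℂ} (hf : ‖f‖ < 1) (hz : ‖z‖ ≤ 1) :
    1 - conj f * z ≠ 0 := by
  intro h
  have h1 : conj f * z = 1 := by linear_combination -h
  have h2 : ‖f‖ * ‖z‖ = 1 := by rw [← Complex.norm_conj f, ← norm_mul, h1, norm_one]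
  nlinarith [norm_nonneg f, norm_nonneg z]

lemma sub_ne_zero_of_norm {f z : ℂ} (hf : ‖f‖ < 1) (hz : 1 ≤ ‖z‖) : z - f ≠ 0 := by
  intro h
  rw [sub_eq_zero.1 h] at hz
  linarith

/-- The unimodular points are the only solutions of a unimodular Blaschke equation. -/
lemma norm_eq_one_of_blaschke {f g l z : ℂ} (hf : ‖f‖ < 1) (hg : ‖g‖ < 1) (hl : ‖l‖ = 1)
    (h : z * (z - f) * (z - g) = l * ((1 - conj f * z) * (1 - conj g * z))) : ‖z‖ = 1 := by
  have hN : Complex.normSq z * Complex.normSq (z - f) * Complex.normSq (z - g) =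
      Complex.normSq (1 - conj f * z) * Complex.normSq (1 - conj g * z) := by
    have := congrArg Complex.normSq h
    simp only [map_mul] at this
    rw [this, Complex.normSq_eq_norm_sq l, hl]; ring
  have kf := normSq_one_sub_conj_mul f z
  have kg := normSq_one_sub_conj_mul g z
  have f1 := normSq_lt_one hf
  have g1 := normSq_lt_one hg
  have pf := Complex.normSq_nonneg (z - f)
  have pg := Complex.normSq_nonneg (z - g)
  -- By the identities `kf` and `kg`, each Blaschke factor has modulus less than 1 inside the disc
  -- and greater than 1 outside, so a unimodular value forces ‖z‖ = 1.
  rcases lt_trichotomy ‖z‖ 1 with hz | hz | hz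
  · exfalso
    have z1 := normSq_lt_one hz
    have qf := Complex.normSq_pos.2 (one_sub_conj_mul_ne_zero hf hz.le)
    have qg := Complex.normSq_pos.2 (one_sub_conj_mul_ne_zero hg hz.le)
    have i1 : Complex.normSq (z - f) ≤ Complex.normSq (1 - conj f * z) := by
      nlinarith [mul_pos (sub_pos.2 f1) (sub_pos.2 z1)]
    have i2 : Complex.normSq (z - g) ≤ Complex.normSq (1 - conj g * z) := by
      nlinarith [mul_pos (sub_pos.2 g1) (sub_pos.2 z1)]
    have i3 := mul_le_mul i1 i2 pg qf.le
    have i4 : Complex.normSq z * (Complex.normSq (z - f) * Complex.normSq (z - g)) ≤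
      Complex.normSq z * (Complex.normSq (1 - conj f * z) * Complex.normSq (1 - conj g * z)) :=
      mul_le_mul_of_nonneg_left i3 (Complex.normSq_nonneg z)
    nlinarith [mul_pos qf qg]
  · exact hz
  · exfalso
    have z1 : 1 < Complex.normSq z := by
      rw [Complex.normSq_eq_norm_sq]; nlinarith
    have qf := Complex.normSq_pos.2 (sub_ne_zero_of_norm hf hz.le)
    have qg := Complex.normSq_pos.2 (sub_ne_zero_of_norm hg hz.le)
    have i1 : Complex.normSq (1 - conj f * z) ≤ Complex.normSq (z - f) := by
      nlinarith [mul_pos (sub_pos.2 f1) (sub_pos.2 z1)]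
    have i2 : Complex.normSq (1 - conj g * z) ≤ Complex.normSq (z - g) := by
      nlinarith [mul_pos (sub_pos.2 g1) (sub_pos.2 z1)]
    have i3 := mul_le_mul i1 i2 (Complex.normSq_nonneg _) qf.le
    nlinarith [mul_pos qf qg]

lemma BlaschkeTriple.blaschke {f g l z₁ z₂ z₃ : ℂ} (h : BlaschkeTriple f g l z₁ z₂ z₃) :
    z₁ * (z₁ - f) * (z₁ - g) = l * ((1 - conj f * z₁) * (1 - conj g * z₁)) := by
  obtain ⟨h1, h2, h3⟩ := h
  linear_combination z₁ ^ 2 * h1 - z₁ * h2 + h3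

/-- Divided by z², the condition says that the product of 2(1 - Re f z̄) and 2(1 - Re g z̄) is
(1-|f|²)(1-|g|²). This is impossible, since 2(1 - Re f z̄) ≥ 2(1-|f|) > 1-|f|², and likewise for g.
-/
lemma not_chordTangent_self {f g z : ℂ} (hf : ‖f‖ < 1) (hg : ‖g‖ < 1) (hz : ‖z‖ = 1) :
    ¬ ChordTangent f g ((1 - f * conj f) * (1 - g * conj g)) z z := by
  intro h
  unfold ChordTangent at h
  have hzz := mul_conj_eq_one hz
  have z0 : z ≠ 0 := by rintro rfl; simp at hz
  have key : (2 - (f * conj z + z * conj f)) * (2 - (g * conj z + z * conj g)) =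
      (1 - f * conj f) * (1 - g * conj g) := by
    have ef : z * (2 - (f * conj z + z * conj f)) = -(f + z * z * conj f - z - z) := by
      linear_combination -f * hzz
    have eg : z * (2 - (g * conj z + z * conj g)) = -(g + z * z * conj g - z - z) := by
      linear_combination -g * hzz
    apply mul_left_cancel₀ (mul_ne_zero z0 z0)
    calc _ = (z * (2 - (f * conj z + z * conj f))) * (z * (2 - (g * conj z + z * conj g))) := by
          ring
      _ = _ := by rw [ef, eg]; linear_combination h
  have real_part (w : ℂ) : 2 - (w * conj z + z * conj w) = ((2 * (1 - (w * conj z).re) : ℝ) : ℂ) := by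
    have : z * conj w = conj (w * conj z) := by simp [mul_comm]
    rw [this, Complex.add_conj]; push_cast; ring
  rw [real_part, real_part, Complex.mul_conj, Complex.mul_conj] at key
  norm_cast at key
  have bound {w : ℂ} (hw : ‖w‖ < 1) :
      1 - Complex.normSq w < 2 * (1 - (w * conj z).re) ∧ 0 < 1 - Complex.normSq w := by
    have h1 : (w * conj z).re ≤ ‖w‖ := by
      calc _ ≤ ‖w * conj z‖ := Complex.re_le_norm _
        _ = ‖w‖ := by rw [norm_mul, Complex.norm_conj, hz, mul_one]
    rw [Complex.normSq_eq_norm_sq]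
    constructor <;> nlinarith [norm_nonneg w]
  obtain ⟨bf, pf⟩ := bound hf
  obtain ⟨bg, pg⟩ := bound hg
  nlinarith [mul_pos (sub_pos.2 bf) (sub_pos.2 bg), mul_pos (sub_pos.2 bf) pg,
    mul_pos (sub_pos.2 bg) pf]

lemma BlaschkeTriple.ne {f g l z₁ z₂ z₃ : ℂ} (h : BlaschkeTriple f g l z₁ z₂ z₃)
    (hf : ‖f‖ < 1) (hg : ‖g‖ < 1) (hz : ‖z₁‖ = 1) : z₁ ≠ z₂ := by
  rintro rfl
  exact not_chordTangent_self hf hg hz h.chordTangent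

lemma exists_blaschkeTriple_of_blaschke {f g l z₁ : ℂ}
    (h : z₁ * (z₁ - f) * (z₁ - g) = l * ((1 - conj f * z₁) * (1 - conj g * z₁))) :
    ∃ z₂ z₃, BlaschkeTriple f g l z₁ z₂ z₃ := by
  set s := f + g + l * (conj f * conj g) - z₁ with hs
  -- The known root is divided out: the other two have sum `s` and product e₂ - z₁ s, and `r` is a
  -- square root of their discriminant.
  obtain ⟨r, hr⟩ := IsAlgClosed.exists_eq_mul_self
    (s ^ 2 - 4 * (f * g + l * (conj f + conj g) - z₁ * s))
  refine ⟨(s + r) / 2, (s - r) / 2, ?_, ?_, ?_⟩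
  · rw [hs]; ring
  · linear_combination hr / 4
  · linear_combination h + hr * z₁ / 4 + z₁ ^ 2 * hs

lemma exists_blaschkeTriple (f g l : ℂ) : ∃ z₁ z₂ z₃, BlaschkeTriple f g l z₁ z₂ z₃ := by
  open Polynomial in
  obtain ⟨z, hz⟩ := IsAlgClosed.exists_root (k := ℂ)
    (X ^ 3 - C (f + g + l * (conj f * conj g)) * X ^ 2 + C (f * g + l * (conj f + conj g)) * X
      - C l) (by
      have : (X ^ 3 - C (f + g + l * (conj f * conj g)) * X ^ 2 +
        C (f * g + l * (conj f + conj g)) * X - C l).degree = 3 := by compute_degree!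
      rw [this]; norm_num)
  simp only [Polynomial.IsRoot.def, Polynomial.eval_sub, Polynomial.eval_add, Polynomial.eval_mul,
    Polynomial.eval_pow, Polynomial.eval_X, Polynomial.eval_C] at hz
  exact ⟨z, exists_blaschkeTriple_of_blaschke (by linear_combination hz)⟩

/-! ### Tangency of a line to an ellipse given by its foci. -/

lemma mem_line_iff {A B X : ℂ} :
    X ∈ (line[ℝ, A, B] : Set ℂ) ↔ ∃ s : ℝ, X = A + s * (B - A) := by
  rw [SetLike.mem_coe, mem_affineSpan_pair_iff_exists_lineMap_eq]
  refine exists_congr fun s => ?_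
  rw [AffineMap.lineMap_apply, vsub_eq_sub, vadd_eq_add, Complex.real_smul, eq_comm, add_comm]

/-- The squared equation factors into the four forms 2m ± |X-f| ± |X-g|; by the triangle inequality
and the bound on the focal distance, three of them are positive. -/
lemma dist_add_dist_eq_iff {f g X : ℂ} {m : ℝ} (hm : dist f g < 2 * m) :
    dist X f + dist X g = 2 * m ↔
      16 * m ^ 2 * Complex.normSq (X - f) =
        (4 * m ^ 2 + Complex.normSq (X - f) - Complex.normSq (X - g)) ^ 2 := by
  rw [Complex.normSq_eq_norm_sq, Complex.normSq_eq_norm_sq, ← dist_eq_norm, ← dist_eq_norm]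
  have h1 := dist_triangle_left f g X
  have h2 := dist_triangle X f g
  have h3 := dist_triangle X g f
  rw [dist_comm g f] at h3
  have p1 : 0 < 2 * m - dist X f + dist X g := by linarith
  have p2 : 0 < 2 * m + dist X f - dist X g := by linarith
  have p3 : 0 < 2 * m + dist X f + dist X g := by linarith
  constructor
  · intro h
    have : m = (dist X f + dist X g) / 2 := by linarith
    rw [this]; ring
  · intro h
    have : (2 * m - dist X f - dist X g) * ((2 * m - dist X f + dist X g) *
        (2 * m + dist X f - dist X g) * (2 * m + dist X f + dist X g)) = 0 := by
      linear_combination -h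
    rcases mul_eq_zero.1 this with h0 | h0
    · linarith
    · exact absurd h0 (by positivity)

lemma existsUnique_quadratic_iff {A B C : ℝ} (hA : A ≠ 0) :
    (∃! s : ℝ, A * s ^ 2 + 2 * B * s + C = 0) ↔ B ^ 2 - A * C = 0 := by
  constructor
  · rintro ⟨s, hs, hu⟩
    -- The second root, by Vieta, must coincide with `s`.
    have hy : A * (-s - 2 * B / A) = -A * s - 2 * B := by field_simp
    have h1 : -s - 2 * B / A = s :=
      hu _ (by linear_combination hs + (-s - 2 * B / A - s) * hy)
    have h2 : B = -(A * s) := by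
      field_simp at h1
      linarith
    subst h2
    linear_combination -A * hs
  · intro h
    refine ⟨-B / A, ?_, fun s hs => ?_⟩
    · field_simp
      linear_combination -h
    · dsimp only at hs
      have : (A * s + B) ^ 2 = 0 := by linear_combination A * hs + h
      have := pow_eq_zero_iff (two_ne_zero) |>.1 this
      field_simp
      linarith

/-- Tangency of a line to an ellipse by the product of the distances from the foci. -/
lemma sideTangent_iff_cross {f g z w : ℂ} {m : ℝ} (hm : dist f g < 2 * m) (hzw : z ≠ w) :
    SideTangent {X | dist X f + dist X g = 2 * m} z w ↔
      4 * ((z - f) * conj (w - z)).im * ((z - g) * conj (w - z)).im =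
        Complex.normSq (w - z) * (4 * m ^ 2 - Complex.normSq (f - g)) := by
  have m0 : 0 < m := by linarith [dist_nonneg (x := f) (y := g)]
  have hk : 0 < 4 * m ^ 2 - Complex.normSq (g - f) := by
    rw [Complex.normSq_eq_norm_sq, ← dist_eq_norm, dist_comm]
    nlinarith [dist_nonneg (x := f) (y := g)]
  have hd : 0 < Complex.normSq (w - z) := Complex.normSq_pos.2 (sub_ne_zero.2 hzw.symm)
  -- Coefficients of the quadratic in `s` obtained by inserting the point z + s(w-z) into the
  -- polynomial equation of the ellipse. Cauchy–Schwarz makes the leading one positive.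
  set A : ℝ := 16 * m ^ 2 * Complex.normSq (w - z) - 4 * ((g - f) * conj (w - z)).re ^ 2 with hA
  set B : ℝ := 16 * m ^ 2 * ((z - f) * conj (w - z)).re - 2 * (4 * m ^ 2 +
    Complex.normSq (z - f) - Complex.normSq (z - g)) * ((g - f) * conj (w - z)).re with hB
  set C : ℝ := 16 * m ^ 2 * Complex.normSq (z - f) - (4 * m ^ 2 +
    Complex.normSq (z - f) - Complex.normSq (z - g)) ^ 2 with hC
  have hA0 : 0 < A := by
    have : ((g - f) * conj (w - z)).re ^ 2 ≤ Complex.normSq (g - f) * Complex.normSq (w - z) := by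
      rw [← Complex.normSq_conj (w - z), ← map_mul, Complex.normSq_apply]
      nlinarith [sq_nonneg ((g - f) * conj (w - z)).im]
    nlinarith [mul_pos hk hd, mul_pos (pow_pos m0 2) hd]
  have e1 : SideTangent {X | dist X f + dist X g = 2 * m} z w ↔
      ∃! s : ℝ, A * s ^ 2 + 2 * B * s + C = 0 := by
    have hinj : ∀ s s' : ℝ, z + s * (w - z) = z + s' * (w - z) → s = s' := by
      intro s s' h
      have := mul_right_cancel₀ (sub_ne_zero.2 hzw.symm) (add_left_cancel h)
      exact_mod_cast this
    have hiff : ∀ s : ℝ, z + s * (w - z) ∈ {X | dist X f + dist X g = 2 * m} ↔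
        A * s ^ 2 + 2 * B * s + C = 0 := by
      intro s
      rw [Set.mem_ofPred_eq, dist_add_dist_eq_iff hm, ← sub_eq_zero]
      refine Eq.congr ?_ rfl
      simp only [hA, hB, hC, Complex.normSq_apply, Complex.sub_re, Complex.sub_im, Complex.mul_re,
        Complex.mul_im, Complex.conj_re, Complex.conj_im, Complex.add_re, Complex.add_im,
        Complex.ofReal_re, Complex.ofReal_im]
      ring
    constructor
    · rintro ⟨X, ⟨hX, hX'⟩, hu⟩
      obtain ⟨s, rfl⟩ := mem_line_iff.1 hX
      exact ⟨s, (hiff s).1 hX', fun s' hs' =>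
        hinj _ _ (hu _ ⟨mem_line_iff.2 ⟨s', rfl⟩, (hiff s').2 hs'⟩)⟩
    · rintro ⟨s, hs, hu⟩
      refine ⟨z + s * (w - z), ⟨mem_line_iff.2 ⟨s, rfl⟩, (hiff s).2 hs⟩, ?_⟩
      rintro Y ⟨hY, hY'⟩
      obtain ⟨s', rfl⟩ := mem_line_iff.1 hY
      rw [hu s' ((hiff s').1 hY')]
  rw [e1, existsUnique_quadratic_iff hA0.ne']
  -- The discriminant is a positive factor times the difference of the two sides of the claim.
  have e2 : B ^ 2 - A * C = 16 * m ^ 2 * (4 * m ^ 2 - Complex.normSq (g - f)) *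
      (Complex.normSq (w - z) * (4 * m ^ 2 - Complex.normSq (f - g)) -
        4 * ((z - f) * conj (w - z)).im * ((z - g) * conj (w - z)).im) := by
    simp only [hA, hB, hC, Complex.normSq_apply, Complex.sub_re, Complex.sub_im, Complex.mul_re,
        Complex.mul_im, Complex.conj_re, Complex.conj_im]
    ring
  rw [e2, mul_eq_zero, or_iff_right (by positivity), sub_eq_zero, eq_comm]

/-- Tangency of a chord of the unit circle. -/
lemma sideTangent_iff_chordTangent {f g z w : ℂ} {m : ℝ} (hm : dist f g < 2 * m) (hzw : z ≠ w)
    (hz : ‖z‖ = 1) (hw : ‖w‖ = 1) :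
    SideTangent {X | dist X f + dist X g = 2 * m} z w ↔
      ChordTangent f g ((4 * m ^ 2 - Complex.normSq (f - g) : ℝ) : ℂ) z w := by
  rw [sideTangent_iff_cross hm hzw, ChordTangent]
  have hz1 := mul_conj_eq_one hz
  have hw1 := mul_conj_eq_one hw
  have z0 : z ≠ 0 := by rintro rfl; simp at hz
  have w0 : w ≠ 0 := by rintro rfl; simp at hw
  have d0 : w - z ≠ 0 := sub_ne_zero.2 hzw.symm
  -- On the unit circle conjugation is inversion, which turns the signed distance of `h` from the
  -- chord into a polynomial in `z`, `w`.
  have cross (h : ℂ) : 2 * Complex.I * (((z - h) * conj (w - z)).im : ℂ) * (z * w) =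
      (w - z) * (h + z * w * conj h - z - w) := by
    have := Complex.sub_conj ((z - h) * conj (w - z))
    push_cast at this
    rw [map_mul, Complex.conj_conj, map_sub conj z h] at this
    linear_combination -(z * w) * this + (z * w) * (z - h) * map_sub conj w z +
      (z ^ 2 - z * h) * hw1 + (w * h - w ^ 2) * hz1
  have hn : (Complex.normSq (w - z) : ℂ) * (z * w) = -(w - z) ^ 2 := by
    rw [← Complex.mul_conj, map_sub]
    linear_combination (w - z) * (z * hw1 - w * hz1)
  rw [← Complex.ofReal_inj]
  push_cast
  have c0 : (z * w) ^ 2 ≠ 0 := pow_ne_zero _ (mul_ne_zero z0 w0)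
  rw [← mul_left_inj' c0]
  have c1 : -(w - z) ^ 2 ≠ 0 := neg_ne_zero.2 (pow_ne_zero _ d0)
  conv_rhs => rw [← mul_right_inj' c1]
  have e1 : 4 * (((z - f) * conj (w - z)).im : ℂ) * (((z - g) * conj (w - z)).im : ℂ) * (z * w) ^ 2 =
      -(w - z) ^ 2 * ((f + z * w * conj f - z - w) * (g + z * w * conj g - z - w)) := by
    have := congrArg₂ (· * ·) (cross f) (cross g)
    linear_combination -this + 4 * (((z - f) * conj (w - z)).im : ℂ) *
      (((z - g) * conj (w - z)).im : ℂ) * (z * w) ^ 2 * Complex.I_sq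
  rw [e1]
  refine Eq.congr rfl ?_
  linear_combination (z * w) * (4 * (m : ℂ) ^ 2 - (Complex.normSq (f - g) : ℂ)) * hn

/-! ### Reflected cevians in complex coordinates. -/

lemma reflection_line_apply {A v X : ℂ} (hv : v ≠ 0) :
    EuclideanGeometry.reflection line[ℝ, A, A + v] X = A + v / conj v * conj (X - A) := by
  have hv' : conj v ≠ 0 := by simpa using hv
  -- Half the difference between `X` and its claimed image: `e` is normal to the line, and X - e is
  -- the foot on the line.
  set e : ℂ := ((X - A) - v / conj v * conj (X - A)) / 2 with he
  have hp : A + (X - A - e) ∈ line[ℝ, A, A + v] := by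
    rw [← SetLike.mem_coe, mem_line_iff]
    refine ⟨((X - A) / v).re, ?_⟩
    rw [Complex.re_eq_add_conj, map_div₀, he]
    field_simp
    ring
  have ho : e ∈ (line[ℝ, A, A + v]).directionᗮ := by
    rw [direction_affineSpan, vectorSpan_pair_rev, vsub_eq_sub, add_sub_cancel_left,
      Submodule.mem_orthogonal_singleton_iff_inner_right, Complex.inner, he, mul_comm]
    have : conj v * ((X - A - v / conj v * conj (X - A)) / 2) =
        (((conj v * (X - A)).im : ℝ) : ℂ) * Complex.I := by
      have h := Complex.sub_conj (conj v * (X - A))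
      push_cast at h
      rw [map_mul, Complex.conj_conj] at h
      field_simp
      linear_combination h
    rw [this]
    simp
  have := EuclideanGeometry.reflection_orthogonal_vadd hp ho
  rw [vadd_eq_add, vadd_eq_add] at this
  rw [show e + (A + (X - A - e)) = X by ring] at this
  rw [this, he]
  ring

/-- With b = B - A and c = C - A, reflection in the bisector sends a direction d to bc d̄/|bc|.
Hence R is on the reflected cevian iff (R-A)(P-A)/(bc) is real, a condition free of norms. -/
lemma mem_reflectedCevian_iff {A B C P R : ℂ} (hP : P ≠ A) (hB : B ≠ A) (hC : C ≠ A)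
    (hn : (B - A) * conj (C - A) ≠ conj (B - A) * (C - A)) :
    R ∈ reflectedCevian A B C P ↔
      (R - A) * (P - A) * (conj (B - A) * conj (C - A)) =
        conj (R - A) * conj (P - A) * ((B - A) * (C - A)) := by
  have b0 : B - A ≠ 0 := sub_ne_zero.2 hB
  have c0 : C - A ≠ 0 := sub_ne_zero.2 hC
  have p0 : P - A ≠ 0 := sub_ne_zero.2 hP
  set b := B - A
  set c := C - A
  set r : ℂ := (‖b‖ : ℂ) with hr
  set s : ℂ := (‖c‖ : ℂ) with hs
  have r0 : r ≠ 0 := by simpa [hr] using b0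
  have s0 : s ≠ 0 := by simpa [hs] using c0
  have hbb : b * conj b = r ^ 2 := Complex.mul_conj' b
  have hcc : c * conj c = s ^ 2 := Complex.mul_conj' c
  set v : ℂ := ‖b‖⁻¹ • b + ‖c‖⁻¹ • c with hv
  have hv1 : v = b / r + c / s := by
    rw [hv, Complex.real_smul, Complex.real_smul, Complex.ofReal_inv, Complex.ofReal_inv, ← hr,
      ← hs, inv_mul_eq_div, inv_mul_eq_div]
  have hv2 : conj v = conj b / r + conj c / s := by
    rw [hv1, map_add, map_div₀, map_div₀, hr, hs, Complex.conj_ofReal, Complex.conj_ofReal]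
  have v0 : v ≠ 0 := by
    intro h0
    apply hn
    have h1 : b * s = -(c * r) := by
      rw [hv1] at h0; field_simp at h0; linear_combination h0
    have h2 : conj b * s = -(conj c * r) := by
      have := hv2; rw [h0, map_zero] at this; field_simp at this; linear_combination -this
    apply mul_right_cancel₀ s0
    linear_combination conj c * h1 - c * h2
  have cv0 : conj v ≠ 0 := by simpa using v0
  have hvv : v / conj v = b * c / (r * s) := by
    rw [div_eq_div_iff cv0 (mul_ne_zero r0 s0), hv2, hv1]
    field_simp
    linear_combination -c * s * hbb - b * r * hcc
  have hmem : R ∈ reflectedCevian A B C P ↔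
      ∃ t : ℝ, R = A + b * c / (r * s) * (t * conj (P - A)) := by
    rw [reflectedCevian, Set.mem_image]
    have key (X : ℂ) : EuclideanGeometry.reflection (bisector A B C) X =
        A + b * c / (r * s) * conj (X - A) := by
      rw [← hvv]; exact reflection_line_apply v0
    constructor
    · rintro ⟨X, hX, rfl⟩
      obtain ⟨t, rfl⟩ := mem_line_iff.1 hX
      exact ⟨t, by rw [key]; simp⟩
    · rintro ⟨t, rfl⟩
      exact ⟨A + t * (P - A), mem_line_iff.2 ⟨t, rfl⟩, by rw [key]; simp⟩
  rw [hmem]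
  constructor
  · rintro ⟨t, rfl⟩
    simp only [map_sub, map_add, map_mul, map_div₀, Complex.conj_conj, Complex.conj_ofReal, hr, hs]
    ring
  · intro h
    have hPP : (P - A) * conj (P - A) ≠ 0 := mul_ne_zero p0 ((map_ne_zero _).2 p0)
    -- The hypothesis says that `W` is real, so it supplies the real scalar along the reflected
    -- cevian.
    set W := (R - A) * (P - A) * (conj b * conj c) with hW
    have hre : conj W = W := by
      conv_rhs => rw [h]
      simp [hW]
    have hWre : (W.re : ℂ) = W := Complex.conj_eq_iff_re.1 hre
    have hpp : (P - A) * conj (P - A) = (Complex.normSq (P - A) : ℂ) := Complex.mul_conj _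
    refine ⟨W.re / (Complex.normSq (P - A) * (‖b‖ * ‖c‖)), ?_⟩
    push_cast
    rw [hWre, ← hpp, ← hr, ← hs, hW]
    have cp0 : conj (P - A) ≠ 0 := (map_ne_zero _).2 p0
    field_simp
    linear_combination (A - R) * s ^ 2 * hbb + (A - R) * b * conj b * hcc

/-! ### The isogonal conjugate as a function of the Poncelet parameter. -/

/-- The position of the isogonal conjugate in the Poncelet family with parameter `l`. -/
def locusPoint (p q : ℝ) (f g u l : ℂ) : ℂ :=
  (p ^ 3 * l - q ^ 3 * u - p ^ 2 * q * (f + g + l * (conj f * conj g)) +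
    p * q ^ 2 * u * (f * g + l * (conj f + conj g))) / (p * q * (u * l - 1))

section

variable {p q : ℝ}

lemma ofReal_sub_mul_ne_zero (hpq : |q| < p) {w : ℂ} (hw : ‖w‖ = 1) : (p : ℂ) - q * w ≠ 0 := by
  intro h
  have h1 : (p : ℂ) = q * w := by linear_combination h
  have h2 := congrArg norm h1
  rw [norm_mul, hw, mul_one, Complex.norm_real, Complex.norm_real, Real.norm_eq_abs,
    Real.norm_eq_abs] at h2
  linarith [le_abs_self p]

lemma ofReal_mul_sub_ne_zero (hpq : |q| < p) {w : ℂ} (hw : ‖w‖ = 1) : (p : ℂ) * w - q ≠ 0 := by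
  intro h
  have h1 : (p : ℂ) * w = q := by linear_combination h
  have h2 := congrArg norm h1
  rw [norm_mul, hw, mul_one, Complex.norm_real, Complex.norm_real, Real.norm_eq_abs,
    Real.norm_eq_abs] at h2
  linarith [le_abs_self p]

/-- The affine image of a unimodular number. -/
def aff (p q : ℝ) (z : ℂ) : ℂ := p * z + q * conj z

lemma ne_zero_of_norm {z : ℂ} (hz : ‖z‖ = 1) : z ≠ 0 := by
  rintro rfl; simp at hz

lemma conj_eq_inv {z : ℂ} (hz : ‖z‖ = 1) : conj z = z⁻¹ :=
  eq_inv_of_mul_eq_one_right (mul_conj_eq_one hz)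

lemma aff_sub {z w : ℂ} (hz : ‖z‖ = 1) (hw : ‖w‖ = 1) :
    aff p q w - aff p q z = (w - z) * (p * (z * w) - q) / (z * w) := by
  have := ne_zero_of_norm hz
  have := ne_zero_of_norm hw
  rw [aff, aff, conj_eq_inv hz, conj_eq_inv hw]
  field_simp
  ring

lemma conj_aff_sub {z w : ℂ} (hz : ‖z‖ = 1) (hw : ‖w‖ = 1) :
    conj (aff p q w - aff p q z) = -((w - z) * (p - q * (z * w)) / (z * w)) := by
  have := ne_zero_of_norm hz
  have := ne_zero_of_norm hw
  rw [aff_sub hz hw, map_div₀, map_mul, map_sub, map_sub, map_mul, map_mul, conj_eq_inv hz,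
    conj_eq_inv hw, Complex.conj_ofReal, Complex.conj_ofReal]
  field_simp
  ring

lemma aff_ne (hpq : |q| < p) {z w : ℂ} (hz : ‖z‖ = 1) (hw : ‖w‖ = 1) (h : w ≠ z) :
    aff p q w ≠ aff p q z := by
  rw [← sub_ne_zero, aff_sub hz hw]
  exact div_ne_zero (mul_ne_zero (sub_ne_zero.2 h)
    (ofReal_mul_sub_ne_zero hpq (by rw [norm_mul, hz, hw, one_mul])))
    (mul_ne_zero (ne_zero_of_norm hz) (ne_zero_of_norm hw))

/-- The left hand side of the equation of the reflected cevian at the first vertex. -/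
def cevianForm (p q : ℝ) (u z₁ z₂ z₃ X : ℂ) : ℂ :=
  (X - aff p q z₁) * (p * (u * z₁) - q) * ((p - q * (z₁ * z₂)) * (p - q * (z₁ * z₃))) +
    (conj X - conj (aff p q z₁)) * (p - q * (u * z₁)) *
      ((p * (z₁ * z₂) - q) * (p * (z₁ * z₃) - q))

lemma mem_reflectedCevian_aff_iff (hpq : |q| < p) {u z₁ z₂ z₃ X : ℂ} (hu : ‖u‖ = 1)
    (h1 : ‖z₁‖ = 1) (h2 : ‖z₂‖ = 1) (h3 : ‖z₃‖ = 1) (h12 : z₁ ≠ z₂) (h23 : z₂ ≠ z₃)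
    (h31 : z₃ ≠ z₁) (hu1 : u ≠ z₁) :
    X ∈ reflectedCevian (aff p q z₁) (aff p q z₂) (aff p q z₃) (aff p q u) ↔
      cevianForm p q u z₁ z₂ z₃ X = 0 := by
  have n1 := ne_zero_of_norm h1
  have n2 := ne_zero_of_norm h2
  have n3 := ne_zero_of_norm h3
  have nu := ne_zero_of_norm hu
  have d1 : z₂ - z₁ ≠ 0 := sub_ne_zero.2 h12.symm
  have d2 : z₃ - z₁ ≠ 0 := sub_ne_zero.2 h31
  have d3 : z₂ - z₃ ≠ 0 := sub_ne_zero.2 h23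
  have du : u - z₁ ≠ 0 := sub_ne_zero.2 hu1
  have hpq2 : (p : ℂ) ^ 2 - q ^ 2 ≠ 0 := by
    norm_cast
    have := abs_lt.1 hpq
    nlinarith
  rw [mem_reflectedCevian_iff (aff_ne hpq h1 hu hu1) (aff_ne hpq h1 h2 h12.symm)
    (aff_ne hpq h1 h3 h31)]
  · rw [conj_aff_sub h1 hu, conj_aff_sub h1 h2, conj_aff_sub h1 h3, aff_sub h1 hu, aff_sub h1 h2,
      aff_sub h1 h3, cevianForm, ← sub_eq_zero, map_sub]
    -- The chord factors that split off from both sides of the isogonality equation.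
    have hc : (u - z₁) * (z₂ - z₁) * (z₃ - z₁) / (u * z₁ ^ 3 * z₂ * z₃) ≠ 0 :=
      div_ne_zero (mul_ne_zero (mul_ne_zero du d1) d2)
        (mul_ne_zero (mul_ne_zero (mul_ne_zero nu (pow_ne_zero _ n1)) n2) n3)
    conv_rhs => rw [← mul_right_inj' hc, mul_zero]
    refine Eq.congr ?_ rfl
    rw [mul_comm z₁ u]
    generalize X - aff p q z₁ = x
    generalize conj X - conj (aff p q z₁) = y
    generalize (p : ℂ) * (u * z₁) - q = a₁
    generalize (p : ℂ) - q * (u * z₁) = a₂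
    generalize (p : ℂ) * (z₁ * z₂) - q = a₃
    generalize (p : ℂ) - q * (z₁ * z₂) = a₄
    generalize (p : ℂ) * (z₁ * z₃) - q = a₅
    generalize (p : ℂ) - q * (z₁ * z₃) = a₆
    generalize u - z₁ = d
    generalize z₂ - z₁ = d₂
    generalize z₃ - z₁ = d₃
    ring
  · rw [conj_aff_sub h1 h2, conj_aff_sub h1 h3, aff_sub h1 h2, aff_sub h1 h3, ← sub_ne_zero]
    have : (z₂ - z₁) * (p * (z₁ * z₂) - q) / (z₁ * z₂) *
        -((z₃ - z₁) * (p - q * (z₁ * z₃)) / (z₁ * z₃)) -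
      -((z₂ - z₁) * (p - q * (z₁ * z₂)) / (z₁ * z₂)) *
        ((z₃ - z₁) * (p * (z₁ * z₃) - q) / (z₁ * z₃)) =
      (z₂ - z₁) * (z₃ - z₁) * (z₂ - z₃) * (q ^ 2 - p ^ 2) / (z₁ * z₂ * z₃) := by
      field_simp
      ring
    rw [this]
    have : (q : ℂ) ^ 2 - p ^ 2 ≠ 0 := by
      rw [← neg_sub]; exact neg_ne_zero.2 hpq2
    exact div_ne_zero (mul_ne_zero (mul_ne_zero (mul_ne_zero d1 d2) d3) this)
      (mul_ne_zero (mul_ne_zero n1 n2) n3)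

/-- The coefficients in `z₁` depend on the triangle only through symmetric functions, so the
conditions at the three vertices are one quadratic evaluated at three points. -/
lemma cevianForm_eq {u z₁ z₂ z₃ X : ℂ} (h1 : ‖z₁‖ = 1) {s₁ s₂ l : ℂ} (e1 : s₁ = z₁ + z₂ + z₃)
    (e2 : s₂ = z₁ * z₂ + z₂ * z₃ + z₃ * z₁) (e3 : l = z₁ * z₂ * z₃) :
    cevianForm p q u z₁ z₂ z₃ X =
      (p * q * (u * l - 1) * (q * X - p * conj X) -
        (p ^ 2 - q ^ 2) * (u * (p ^ 2 + q ^ 2) - p * q * u * s₂ + p * q * l)) * z₁ ^ 2 +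
      ((p ^ 3 * u - q ^ 3 * l - p ^ 2 * q * u * s₂ + p * q ^ 2 * s₁) * X +
        (p ^ 3 * l - q ^ 3 * u - p ^ 2 * q * s₁ + p * q ^ 2 * u * s₂) * conj X) * z₁ +
      (p * q * (u * l - 1) * (p * X - q * conj X) -
        (p ^ 2 - q ^ 2) * (p * q * (u - s₁) + l * (p ^ 2 + q ^ 2))) := by
  have n1 := ne_zero_of_norm h1
  subst e1 e2 e3
  rw [cevianForm, aff, map_add, map_mul, map_mul, Complex.conj_conj, conj_eq_inv h1,
    Complex.conj_ofReal, Complex.conj_ofReal]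
  field_simp
  ring

end

section

variable {p q : ℝ}

lemma sq_sub_sq_ne_zero (hpq : |q| < p) : (p : ℂ) ^ 2 - q ^ 2 ≠ 0 := by
  norm_cast
  have := abs_lt.1 hpq
  nlinarith

lemma left_ne_zero (hpq : |q| < p) : (p : ℂ) ≠ 0 := by
  have : 0 < p := (abs_nonneg q).trans_lt hpq
  exact_mod_cast this.ne'

lemma mul_locusPoint (hpq : |q| < p) (hq : q ≠ 0) {f g u l : ℂ} (hul : u * l ≠ 1) :
    p * q * (u * l - 1) * locusPoint p q f g u l =
      p ^ 3 * l - q ^ 3 * u - p ^ 2 * q * (f + g + l * (conj f * conj g)) +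
        p * q ^ 2 * u * (f * g + l * (conj f + conj g)) := by
  have h1 := left_ne_zero hpq
  have h2 : (q : ℂ) ≠ 0 := by exact_mod_cast hq
  have h3 := sub_ne_zero.2 hul
  rw [locusPoint, mul_div_cancel₀ _ (mul_ne_zero (mul_ne_zero h1 h2) h3)]

/-- For unimodular l, conjugation sends the first symmetric function to the second divided by l.
After multiplication by -ul its effect is to exchange p and q on the right. -/
lemma mul_conj_locusPoint (hpq : |q| < p) (hq : q ≠ 0) {f g u l : ℂ} (hu : ‖u‖ = 1) (hl : ‖l‖ = 1)
    (hul : u * l ≠ 1) :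
    p * q * (u * l - 1) * conj (locusPoint p q f g u l) =
      q ^ 3 * l - p ^ 3 * u - p * q ^ 2 * (f + g + l * (conj f * conj g)) +
        p ^ 2 * q * u * (f * g + l * (conj f + conj g)) := by
  have h := congrArg conj (mul_locusPoint hpq hq (f := f) (g := g) hul)
  simp only [map_sub, map_add, map_mul, map_pow, Complex.conj_conj, Complex.conj_ofReal,
    map_one] at h
  have hu1 := mul_conj_eq_one hu
  have hl1 := mul_conj_eq_one hl
  linear_combination -(u * l) * h +
    (l * conj l * (p * q * conj (locusPoint p q f g u l) - p * q ^ 2 * (f + g)) -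
      p * q ^ 2 * l * (conj f * conj g) + q ^ 3 * l) * hu1 +
    (p * q * conj (locusPoint p q f g u l) - p * q ^ 2 * (f + g) + p ^ 2 * q * u * (f * g) -
      p ^ 3 * u) * hl1

lemma isIsogonalConjugate_aff_iff (hpq : |q| < p) (hq : q ≠ 0) {f g l u z₁ z₂ z₃ X : ℂ}
    (hu : ‖u‖ = 1) (h1 : ‖z₁‖ = 1) (h2 : ‖z₂‖ = 1) (h3 : ‖z₃‖ = 1) (h12 : z₁ ≠ z₂) (h23 : z₂ ≠ z₃)
    (h31 : z₃ ≠ z₁) (hu1 : u ≠ z₁) (hu2 : u ≠ z₂) (hu3 : u ≠ z₃)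
    (hB : BlaschkeTriple f g l z₁ z₂ z₃) :
    IsIsogonalConjugate (aff p q z₁) (aff p q z₂) (aff p q z₃) (aff p q u) X ↔
      u * l ≠ 1 ∧ X = locusPoint p q f g u l := by
  have hD := sq_sub_sq_ne_zero hpq
  have hp0 := left_ne_zero hpq
  have hq0 : (q : ℂ) ≠ 0 := by exact_mod_cast hq
  have hl : ‖l‖ = 1 := by rw [← hB.prod, norm_mul, norm_mul, h1, h2, h3]; norm_num
  have hiff : IsIsogonalConjugate (aff p q z₁) (aff p q z₂) (aff p q z₃) (aff p q u) X ↔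
      cevianForm p q u z₁ z₂ z₃ X = 0 ∧ cevianForm p q u z₂ z₃ z₁ X = 0 ∧
        cevianForm p q u z₃ z₁ z₂ X = 0 := by
    rw [← mem_reflectedCevian_aff_iff hpq hu h1 h2 h3 h12 h23 h31 hu1,
      ← mem_reflectedCevian_aff_iff hpq hu h2 h3 h1 h23 h31 h12 hu2,
      ← mem_reflectedCevian_aff_iff hpq hu h3 h1 h2 h31 h12 h23 hu3]
    exact ⟨fun h => ⟨h.mem_A, h.mem_B, h.mem_C⟩, fun h => ⟨aff_ne hpq h1 hu hu1,
      aff_ne hpq h2 hu hu2, aff_ne hpq h3 hu hu3, h.1, h.2.1, h.2.2⟩⟩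
  have E1 := fun X => cevianForm_eq (p := p) (q := q) (u := u) (X := X) h1 hB.sum.symm
    hB.sum_mul.symm hB.prod.symm
  have E2 := fun X => cevianForm_eq (p := p) (q := q) (u := u) (X := X) h2 hB.rotate.sum.symm
    hB.rotate.sum_mul.symm hB.rotate.prod.symm
  have E3 := fun X => cevianForm_eq (p := p) (q := q) (u := u) (X := X) h3
    hB.rotate.rotate.sum.symm hB.rotate.rotate.sum_mul.symm hB.rotate.rotate.prod.symm
  rw [hiff, E2, E3]
  set s₁ := f + g + l * (conj f * conj g) with hs₁
  set s₂ := f * g + l * (conj f + conj g) with hs₂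
  constructor
  · rintro ⟨e1, e2, e3⟩
    rw [E1] at e1
    -- The outer coefficients form a linear system in X and X̄, solved in `hN` and `hM`; the middle
    -- one is then automatic.
    obtain ⟨c0, c1, c2⟩ := quadratic_coeffs_eq_zero h12 h23 h31 e1 e2 e3
    have hN : p * q * (u * l - 1) * X =
        p ^ 3 * l - q ^ 3 * u - p ^ 2 * q * s₁ + p * q ^ 2 * u * s₂ := by
      apply mul_left_cancel₀ hD
      linear_combination p * c0 - q * c2
    have hM : p * q * (u * l - 1) * conj X =
        q ^ 3 * l - p ^ 3 * u - p * q ^ 2 * s₁ + p ^ 2 * q * u * s₂ := by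
      apply mul_left_cancel₀ hD
      linear_combination q * c0 - p * c2
    have hul : u * l ≠ 1 := by
      intro hul
      -- At ul = 1 the outer coefficients no longer involve the point, and `hN`, `hM` make the
      -- middle one vanish for every `Y`. Evaluation at two independent displacements contradicts
      -- the nonzero coefficient of `Y`.
      have hE : ∀ Y, cevianForm p q u z₁ z₂ z₃ Y = 0 := by
        intro Y
        rw [E1]
        rw [hul] at hN hM c0 c2
        rw [hul]
        linear_combination c0 + z₁ ^ 2 * c2 + z₁ * Y * hM - z₁ * conj Y * hN
      have a1 := hE (aff p q z₁ + 1)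
      have a2 := hE (aff p q z₁ + Complex.I)
      rw [cevianForm, add_sub_cancel_left, map_add, add_sub_cancel_left, map_one] at a1
      rw [cevianForm, add_sub_cancel_left, map_add, add_sub_cancel_left, Complex.conj_I] at a2
      have a3 : ((p : ℂ) * (u * z₁) - q) * ((p - q * (z₁ * z₂)) * (p - q * (z₁ * z₃))) = 0 := by
        linear_combination (a1 - Complex.I * a2) / 2 +
          (((p : ℂ) * (u * z₁) - q) * ((p - q * (z₁ * z₂)) * (p - q * (z₁ * z₃))) -
            (p - q * (u * z₁)) * ((p * (z₁ * z₂) - q) * (p * (z₁ * z₃) - q))) / 2 * Complex.I_sq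
      exact mul_ne_zero (ofReal_mul_sub_ne_zero hpq (by rw [norm_mul, hu, h1, one_mul]))
        (mul_ne_zero (ofReal_sub_mul_ne_zero hpq (by rw [norm_mul, h1, h2, one_mul]))
          (ofReal_sub_mul_ne_zero hpq (by rw [norm_mul, h1, h3, one_mul]))) a3
    refine ⟨hul, mul_left_cancel₀ (mul_ne_zero (mul_ne_zero hp0 hq0) (sub_ne_zero.2 hul)) ?_⟩
    rw [hN, mul_locusPoint hpq hq hul]
  · rintro ⟨hul, rfl⟩
    have hN := mul_locusPoint hpq hq (f := f) (g := g) hul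
    have hM := mul_conj_locusPoint hpq hq (f := f) (g := g) hu hl hul
    rw [← hs₁, ← hs₂] at hN hM
    rw [E1]
    generalize locusPoint p q f g u l = X at *
    have c0 : p * q * (u * l - 1) * (p * X - q * conj X) -
        (p ^ 2 - q ^ 2) * (p * q * (u - s₁) + l * (p ^ 2 + q ^ 2)) = 0 := by
      linear_combination p * hN - q * hM
    have c2 : p * q * (u * l - 1) * (q * X - p * conj X) -
        (p ^ 2 - q ^ 2) * (u * (p ^ 2 + q ^ 2) - p * q * u * s₂ + p * q * l) = 0 := by
      linear_combination q * hN - p * hM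
    have c1 : (p ^ 3 * u - q ^ 3 * l - p ^ 2 * q * u * s₂ + p * q ^ 2 * s₁) * X +
        (p ^ 3 * l - q ^ 3 * u - p ^ 2 * q * s₁ + p * q ^ 2 * u * s₂) * conj X = 0 := by
      linear_combination X * hM - conj X * hN
    rw [c0, c1, c2]
    simp

lemma mem_line_iff_conj {A B X : ℂ} (hAB : B ≠ A) :
    X ∈ (line[ℝ, A, B] : Set ℂ) ↔ (X - A) * conj (B - A) = conj (X - A) * (B - A) := by
  have h0 : B - A ≠ 0 := sub_ne_zero.2 hAB
  have h1 : conj (B - A) ≠ 0 := (map_ne_zero _).2 h0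
  rw [mem_line_iff]
  constructor
  · rintro ⟨s, rfl⟩
    simp only [add_sub_cancel_left, map_mul, Complex.conj_ofReal]
    ring
  · intro h
    have hre : conj ((X - A) / (B - A)) = (X - A) / (B - A) := by
      rw [map_div₀, div_eq_div_iff h1 h0, h]
    refine ⟨((X - A) / (B - A)).re, ?_⟩
    rw [Complex.conj_eq_iff_re.1 hre]
    field_simp
    ring

lemma mem_line_aff_iff (hpq : |q| < p) {z w X : ℂ} (hz : ‖z‖ = 1) (hw : ‖w‖ = 1) (hzw : z ≠ w) :
    X ∈ (line[ℝ, aff p q z, aff p q w] : Set ℂ) ↔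
      (p * X - q * conj X) + z * w * (p * conj X - q * X) = (p ^ 2 - q ^ 2) * (z + w) := by
  have z0 := ne_zero_of_norm hz
  have w0 := ne_zero_of_norm hw
  have hd : w - z ≠ 0 := sub_ne_zero.2 hzw.symm
  rw [mem_line_iff_conj (aff_ne hpq hz hw hzw.symm), conj_aff_sub hz hw, aff_sub hz hw]
  have h1 : (X - aff p q z) * -((w - z) * (p - q * (z * w)) / (z * w)) -
      conj (X - aff p q z) * ((w - z) * (p * (z * w) - q) / (z * w)) =
      -(w - z) / (z * w) * (((p * X - q * conj X) + z * w * (p * conj X - q * X)) -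
        (p ^ 2 - q ^ 2) * (z + w)) := by
    rw [map_sub, aff, map_add, map_mul, map_mul, Complex.conj_conj, conj_eq_inv hz,
      Complex.conj_ofReal, Complex.conj_ofReal]
    field_simp
    ring
  rw [← sub_eq_zero, h1, mul_eq_zero, or_iff_right, sub_eq_zero]
  exact div_ne_zero (neg_ne_zero.2 hd) (mul_ne_zero z0 w0)

/-- With r = Re(fg) the expression is ((1+r)(p-q)² + (1-r)(p+q)²)/2, where |r| ≤ 1 and both squares
are positive. -/
lemma line_coeff_ne_zero (hpq : |q| < p) {f g : ℂ} (hf : ‖f‖ < 1) (hg : ‖g‖ < 1) :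
    (p : ℂ) ^ 2 + q ^ 2 - p * q * (f * g + conj f * conj g) ≠ 0 := by
  rw [← map_mul, Complex.add_conj]
  norm_cast
  have h1 : |(f * g).re| ≤ 1 := by
    refine (Complex.abs_re_le_norm _).trans ?_
    rw [norm_mul]
    nlinarith [norm_nonneg f, norm_nonneg g]
  obtain ⟨h2, h3⟩ := abs_le.1 h1
  obtain ⟨h4, h5⟩ := abs_lt.1 hpq
  intro h
  nlinarith [sq_pos_of_pos (sub_pos.2 h5), sq_pos_of_pos (by linarith : 0 < p + q),
    mul_nonneg (sub_nonneg.2 h3) (sq_nonneg (p + q)),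
    mul_nonneg (by linarith : 0 ≤ 1 + (f * g).re) (sq_nonneg (p - q))]

/-- The side opposite to the apex `u` meets the locus only at the excluded parameter. -/
lemma locusPoint_mem_line_iff (hpq : |q| < p) (hq : q ≠ 0) {f g u l l₀ z w : ℂ} (hf : ‖f‖ < 1)
    (hg : ‖g‖ < 1) (hu : ‖u‖ = 1) (hl : ‖l‖ = 1) (hz : ‖z‖ = 1) (hw : ‖w‖ = 1) (hzw : z ≠ w)
    (hul : u * l ≠ 1) (hB : BlaschkeTriple f g l₀ u z w) :
    locusPoint p q f g u l ∈ (line[ℝ, aff p q z, aff p q w] : Set ℂ) ↔ l = l₀ := by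
  have hD := sq_sub_sq_ne_zero hpq
  have hc : (p : ℂ) * q * (u * l - 1) ≠ 0 :=
    mul_ne_zero (mul_ne_zero (left_ne_zero hpq) (by exact_mod_cast hq)) (sub_ne_zero.2 hul)
  have hN := mul_locusPoint hpq hq (f := f) (g := g) hul
  have hM := mul_conj_locusPoint hpq hq (f := f) (g := g) hu hl hul
  rw [mem_line_aff_iff hpq hz hw hzw, ← sub_eq_zero, ← mul_right_inj' hc, mul_zero]
  -- The relations of the triple eliminate `z` and `w`, leaving a nonzero constant times l - l₀.
  have key : p * q * (u * l - 1) * ((p * locusPoint p q f g u l -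
      q * conj (locusPoint p q f g u l)) + z * w * (p * conj (locusPoint p q f g u l) -
        q * locusPoint p q f g u l) - (p ^ 2 - q ^ 2) * (z + w)) =
      (p ^ 2 - q ^ 2) * (p ^ 2 + q ^ 2 - p * q * (f * g + conj f * conj g)) * (l - l₀) := by
    obtain ⟨e1, e2, e3⟩ := hB
    subst e3
    linear_combination (p - z * w * q) * hN + (z * w * p - q) * hM +
      p * q * (p ^ 2 - q ^ 2) * e1 - p * q * (p ^ 2 - q ^ 2) * l * e2
  rw [key, mul_eq_zero, or_iff_right (mul_ne_zero hD (line_coeff_ne_zero hpq hf hg)), sub_eq_zero]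

end

/-! ### The locus is a line: Möbius image of a circle through the pole. -/

section

/-- The value `α ū` for the Möbius parametrization `(α l + β) / (p q (u l - 1))` of the locus. -/
def mobiusLead (p q : ℝ) (f g u : ℂ) : ℂ :=
  (p ^ 3 - p ^ 2 * q * (conj f * conj g)) * conj u + p * q ^ 2 * (conj f + conj g)

/-- The value `β` for the Möbius parametrization `(α l + β) / (p q (u l - 1))` of the locus. -/
def mobiusConst (p q : ℝ) (f g u : ℂ) : ℂ :=
  p * q ^ 2 * u * (f * g) - q ^ 3 * u - p ^ 2 * q * (f + g)

/-- The locus with the removed point added. -/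
def locusLine (p q : ℝ) (f g u : ℂ) : Set ℂ :=
  {X | ∃ l : ℂ, ‖l‖ = 1 ∧ u * l ≠ 1 ∧ X = locusPoint p q f g u l}

/-- The Cayley substitution ul = (s+i)/(s-i) turns the Möbius expression into `locusBase` + s ·
`locusDir` with s real. -/
def locusBase (p q : ℝ) (f g u : ℂ) : ℂ :=
  (mobiusLead p q f g u - mobiusConst p q f g u) / (2 * p * q)

def locusDir (p q : ℝ) (f g u : ℂ) : ℂ :=
  -Complex.I * (mobiusLead p q f g u + mobiusConst p q f g u) / (2 * p * q)

variable {p q : ℝ}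

lemma locusPoint_eq {f g u l : ℂ} (hu : ‖u‖ = 1) :
    locusPoint p q f g u l = (mobiusLead p q f g u * (u * l) + mobiusConst p q f g u) /
      (p * q * (u * l - 1)) := by
  rw [locusPoint, mobiusLead, mobiusConst]
  congr 1
  linear_combination -(p ^ 3 - p ^ 2 * q * (conj f * conj g)) * l * mul_conj_eq_one hu

/-- A zero sum would make the Möbius map constant. It would give p(p-quf)(p-qug) = q(qu-pf̄)(qu-pḡ),
but the left side has larger modulus: |p-quf|² - |qu-pf̄|² = (p²-q²)(1-|f|²) > 0, and likewise for
g. -/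
lemma mobius_sum_ne_zero (hpq : |q| < p) {f g u : ℂ} (hf : ‖f‖ < 1) (hg : ‖g‖ < 1)
    (hu : ‖u‖ = 1) : mobiusLead p q f g u + mobiusConst p q f g u ≠ 0 := by
  intro h
  have h1 : p * ((p - q * u * f) * (p - q * u * g)) =
      q * ((q * u - p * conj f) * (q * u - p * conj g)) := by
    rw [mobiusLead, mobiusConst] at h
    linear_combination u * h - (p ^ 3 - p ^ 2 * q * (conj f * conj g)) * mul_conj_eq_one hu
  have h2 := congrArg Complex.normSq h1
  simp only [map_mul, Complex.normSq_ofReal] at h2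
  have hu2 : u.re * u.re + u.im * u.im = 1 := by
    rw [← Complex.normSq_apply, Complex.normSq_eq_norm_sq, hu]; norm_num
  have comp {w : ℂ} (hw : ‖w‖ < 1) :
      Complex.normSq (q * u - p * conj w) < Complex.normSq (p - q * u * w) := by
    have e : Complex.normSq (p - q * u * w) - Complex.normSq (q * u - p * conj w) =
        (p - q) * (p + q) * (1 - Complex.normSq w) := by
      simp only [Complex.normSq_apply, Complex.sub_re, Complex.sub_im, Complex.mul_re,
        Complex.mul_im, Complex.conj_re, Complex.conj_im, Complex.ofReal_re, Complex.ofReal_im]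
      linear_combination (q ^ 2 * (w.re ^ 2 + w.im ^ 2) - q ^ 2) * hu2
    have hw2 := normSq_lt_one hw
    obtain ⟨h4, h5⟩ := abs_lt.1 hpq
    have : 0 < (p - q) * (p + q) * (1 - Complex.normSq w) := by
      apply mul_pos (mul_pos _ _) <;> linarith
    linarith
  have cf := comp hf
  have cg := comp hg
  have hsq : q * q < p * p := by
    obtain ⟨h4, h5⟩ := abs_lt.1 hpq
    nlinarith
  have nf := Complex.normSq_nonneg (q * u - p * conj f)
  have ng := Complex.normSq_nonneg (q * u - p * conj g)
  have i1 := mul_lt_mul'' cf cg nf ng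
  have i2 := mul_lt_mul'' hsq i1 (mul_self_nonneg q) (mul_nonneg nf ng)
  linarith

lemma locusDir_ne_zero (hpq : |q| < p) (hq : q ≠ 0) {f g u : ℂ} (hf : ‖f‖ < 1) (hg : ‖g‖ < 1)
    (hu : ‖u‖ = 1) : locusDir p q f g u ≠ 0 :=
  div_ne_zero (mul_ne_zero (neg_ne_zero.2 Complex.I_ne_zero) (mobius_sum_ne_zero hpq hf hg hu))
    (mul_ne_zero (mul_ne_zero two_ne_zero (left_ne_zero hpq)) (by exact_mod_cast hq))

lemma cayley_ne (s : ℝ) : (s : ℂ) - Complex.I ≠ 0 := by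
  intro h
  have := congrArg Complex.im h
  simp at this

lemma locusLine_eq (hpq : |q| < p) (hq : q ≠ 0) {f g u : ℂ} (hu : ‖u‖ = 1) :
    locusLine p q f g u =
      (line[ℝ, locusBase p q f g u, locusBase p q f g u + locusDir p q f g u] : Set ℂ) := by
  have hp0 := left_ne_zero hpq
  have hq0 : (q : ℂ) ≠ 0 := by exact_mod_cast hq
  have hu1 := mul_conj_eq_one hu
  have u0 := ne_zero_of_norm hu
  have I2 := Complex.I_sq
  ext X
  rw [mem_line_iff, locusLine, Set.mem_ofPred_eq, add_sub_cancel_left]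
  constructor
  · rintro ⟨l, hl, hul, rfl⟩
    have hl1 := mul_conj_eq_one hl
    have hk : u * l - 1 ≠ 0 := sub_ne_zero.2 hul
    -- The inverse Cayley transform of ul, real because |ul| = 1.
    set s : ℂ := Complex.I * (u * l + 1) / (u * l - 1) with hs
    have hre : conj s = s := by
      have hk' : conj u * conj l - 1 ≠ 0 := by
        rw [← map_mul, ← map_one conj, ← map_sub]; exact (map_ne_zero _).2 hk
      rw [hs, map_div₀, map_mul, map_add, map_sub, map_one, Complex.conj_I, map_mul,
        div_eq_div_iff hk' hk]
      linear_combination -2 * Complex.I * (l * conj l * hu1 + hl1)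
    refine ⟨s.re, ?_⟩
    rw [Complex.conj_eq_iff_re.1 hre, locusPoint_eq hu, locusBase, locusDir, hs]
    field_simp
    linear_combination (u * l + 1) * (mobiusLead p q f g u + mobiusConst p q f g u) * I2
  · rintro ⟨s, rfl⟩
    have hs := cayley_ne s
    have hs' : (s : ℂ) + Complex.I ≠ 0 := by
      intro h
      have := congrArg Complex.im h
      simp at this
    have hκ : ‖((s : ℂ) + Complex.I) / (s - Complex.I)‖ = 1 := by
      have : (s : ℂ) + Complex.I = conj ((s : ℂ) - Complex.I) := by simp
      rw [norm_div, this, Complex.norm_conj, div_self (norm_ne_zero_iff.2 hs)]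
    have hul : u * (conj u * (((s : ℂ) + Complex.I) / (s - Complex.I))) =
        ((s : ℂ) + Complex.I) / (s - Complex.I) := by
      rw [← mul_assoc, hu1, one_mul]
    have hsub : ((s : ℂ) + Complex.I) / (s - Complex.I) - 1 = 2 * Complex.I / (s - Complex.I) := by
      field_simp
      ring
    have h2I : 2 * Complex.I / (s - Complex.I) ≠ 0 :=
      div_ne_zero (mul_ne_zero two_ne_zero Complex.I_ne_zero) hs
    refine ⟨conj u * (((s : ℂ) + Complex.I) / (s - Complex.I)), ?_, ?_, ?_⟩
    · rw [norm_mul, hκ, Complex.norm_conj, hu, one_mul]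
    · rw [hul, ← sub_ne_zero, hsub]
      exact h2I
    · have I0 := Complex.I_ne_zero
      rw [locusPoint_eq hu, hul, hsub, locusBase, locusDir]
      field_simp
      linear_combination -s * (mobiusLead p q f g u + mobiusConst p q f g u) * I2

/-- The point of the unit circle with rational parameter `t`. -/
def circlePoint (t : ℝ) : ℂ := ⟨(1 - t ^ 2) / (1 + t ^ 2), 2 * t / (1 + t ^ 2)⟩

lemma norm_circlePoint (t : ℝ) : ‖circlePoint t‖ = 1 := by
  have : (1 + t ^ 2) ≠ 0 := by positivity
  rw [← sq_eq_sq₀ (norm_nonneg _) zero_le_one, ← Complex.normSq_eq_norm_sq, Complex.normSq_apply,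
    circlePoint]
  field_simp
  ring

lemma removedDen_eq (a b t : ℝ) (f g : ℂ) :
    removedDen a b f.re f.im g.re g.im t = (a - b) * (a + b) * (1 + t ^ 2) ^ 2 *
      ((circlePoint t - f) * (circlePoint t - g)).im := by
  have : (1 + t ^ 2) ≠ 0 := by positivity
  simp only [removedDen, circlePoint, Complex.sub_re, Complex.sub_im, Complex.mul_im]
  field_simp
  ring

/-- With α, β the Möbius coefficients, the line has base (α-β)/(2pq) and direction -i(α+β) up to a
real factor, so membership is the vanishing of a real part; here 2pq = (a²-b²)/2. -/
lemma lineForm_eq (a b t : ℝ) (f g z : ℂ) :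
    lineForm a b f.re f.im g.re g.im t z.re z.im = -16 * (1 + t ^ 2) *
      ((((a ^ 2 - b ^ 2) / 2 : ℝ) * z - (mobiusLead ((a + b) / 2) ((a - b) / 2) f g (circlePoint t) -
        mobiusConst ((a + b) / 2) ((a - b) / 2) f g (circlePoint t))) *
      conj (mobiusLead ((a + b) / 2) ((a - b) / 2) f g (circlePoint t) +
        mobiusConst ((a + b) / 2) ((a - b) / 2) f g (circlePoint t))).re := by
  have : (1 + t ^ 2) ≠ 0 := by positivity
  have hp2 (r : ℝ) : (r : ℂ) ^ 2 = (r ^ 2 : ℝ) := by push_cast; rfl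
  have hp3 (r : ℝ) : (r : ℂ) ^ 3 = (r ^ 3 : ℝ) := by push_cast; rfl
  simp only [lineForm, circlePoint, mobiusLead, mobiusConst, hp2, hp3, Complex.sub_re,
    Complex.sub_im, Complex.mul_im, Complex.mul_re, Complex.conj_re, Complex.conj_im,
    Complex.add_re, Complex.add_im, Complex.ofReal_re, Complex.ofReal_im]
  field_simp
  ring

end

/-! ### The removed point. -/

section

variable {p q : ℝ}

lemma one_sub_conj_mul_mul_eq (f g u : ℂ) (hu : ‖u‖ = 1) :
    (1 - conj f * u) * (1 - conj g * u) = u ^ 2 * conj ((u - f) * (u - g)) := by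
  have hu1 := mul_conj_eq_one hu
  rw [map_mul, map_sub, map_sub]
  linear_combination (conj f * u + conj g * u - u * conj u - 1) * hu1

lemma mul_eq_of_blaschke {f g u l : ℂ} (hu : ‖u‖ = 1)
    (h : u * (u - f) * (u - g) = l * ((1 - conj f * u) * (1 - conj g * u))) :
    (u - f) * (u - g) = u * l * conj ((u - f) * (u - g)) := by
  apply mul_left_cancel₀ (ne_zero_of_norm hu)
  rw [one_sub_conj_mul_mul_eq f g u hu] at h
  linear_combination h

/-- With w = (u-f)(u-g), the Blaschke equation at u reads ul = w / w̄, which is 1 exactly for real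
w. -/
lemma mul_eq_one_iff_of_blaschke {f g u l : ℂ} (hf : ‖f‖ < 1) (hg : ‖g‖ < 1) (hu : ‖u‖ = 1)
    (h : u * (u - f) * (u - g) = l * ((1 - conj f * u) * (1 - conj g * u))) :
    u * l = 1 ↔ ((u - f) * (u - g)).im = 0 := by
  have h1 := mul_eq_of_blaschke hu h
  have h0 : (u - f) * (u - g) ≠ 0 :=
    mul_ne_zero (sub_ne_zero_of_norm hf hu.ge) (sub_ne_zero_of_norm hg hu.ge)
  rw [← Complex.conj_eq_iff_im]
  constructor
  · intro e
    rw [e, one_mul] at h1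
    exact h1.symm
  · intro e
    rw [e] at h1
    exact mul_right_cancel₀ h0 (by rw [one_mul]; exact h1.symm)

/-- Inserting ul = w / w̄ into the Möbius expression gives (αw + βw̄)/(2i pq Im w); the two
numerators are multiples of the imaginary and real parts of αw + βw̄. -/
lemma removedNumX_eq (a b t : ℝ) (f g : ℂ) :
    removedNumX a b f.re f.im g.re g.im t = 2 * (1 + t ^ 2) ^ 2 *
      (mobiusLead ((a + b) / 2) ((a - b) / 2) f g (circlePoint t) *
          ((circlePoint t - f) * (circlePoint t - g)) +
        mobiusConst ((a + b) / 2) ((a - b) / 2) f g (circlePoint t) *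
          conj ((circlePoint t - f) * (circlePoint t - g))).im := by
  have : (1 + t ^ 2) ≠ 0 := by positivity
  have hp2 (r : ℝ) : (r : ℂ) ^ 2 = (r ^ 2 : ℝ) := by push_cast; rfl
  have hp3 (r : ℝ) : (r : ℂ) ^ 3 = (r ^ 3 : ℝ) := by push_cast; rfl
  simp only [removedNumX, circlePoint, mobiusLead, mobiusConst, hp2, hp3, Complex.sub_re,
    Complex.sub_im, Complex.mul_im, Complex.mul_re, Complex.conj_re, Complex.conj_im,
    Complex.add_re, Complex.add_im, Complex.ofReal_re, Complex.ofReal_im]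
  field_simp
  ring

lemma removedNumY_eq (a b t : ℝ) (f g : ℂ) :
    removedNumY a b f.re f.im g.re g.im t = -4 * (1 + t ^ 2) ^ 2 *
      (mobiusLead ((a + b) / 2) ((a - b) / 2) f g (circlePoint t) *
          ((circlePoint t - f) * (circlePoint t - g)) +
        mobiusConst ((a + b) / 2) ((a - b) / 2) f g (circlePoint t) *
          conj ((circlePoint t - f) * (circlePoint t - g))).re := by
  have : (1 + t ^ 2) ≠ 0 := by positivity
  have hp2 (r : ℝ) : (r : ℂ) ^ 2 = (r ^ 2 : ℝ) := by push_cast; rfl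
  have hp3 (r : ℝ) : (r : ℂ) ^ 3 = (r ^ 3 : ℝ) := by push_cast; rfl
  simp only [removedNumY, circlePoint, mobiusLead, mobiusConst, hp2, hp3, Complex.sub_re,
    Complex.sub_im, Complex.mul_im, Complex.mul_re, Complex.conj_re, Complex.conj_im,
    Complex.add_re, Complex.add_im, Complex.ofReal_re, Complex.ofReal_im]
  field_simp
  ring

lemma removedPoint_eq {a b t : ℝ} (ha : 0 < a) (hb : 0 < b) (hab : a ≠ b) {f g l : ℂ}
    (h : circlePoint t * (circlePoint t - f) * (circlePoint t - g) =
      l * ((1 - conj f * circlePoint t) * (1 - conj g * circlePoint t)))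
    (him : ((circlePoint t - f) * (circlePoint t - g)).im ≠ 0) :
    removedPoint a b f.re f.im g.re g.im t =
      locusPoint ((a + b) / 2) ((a - b) / 2) f g (circlePoint t) l := by
  have hu := norm_circlePoint t
  have hw := mul_eq_of_blaschke hu h
  have hX := removedNumX_eq a b t f g
  have hY := removedNumY_eq a b t f g
  have hD := removedDen_eq a b t f g
  rw [locusPoint_eq hu]
  generalize circlePoint t = u at *
  generalize mobiusLead ((a + b) / 2) ((a - b) / 2) f g u = α at *
  generalize mobiusConst ((a + b) / 2) ((a - b) / 2) f g u = β at *
  set w := (u - f) * (u - g) with hwdef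
  set N := α * w + β * conj w with hN
  have hden : removedDen a b f.re f.im g.re g.im t ≠ 0 := by
    rw [hD]
    have : a - b ≠ 0 := sub_ne_zero.2 hab
    have : a + b ≠ 0 := by positivity
    positivity
  have hcw : conj w ≠ 0 := by
    intro h0
    rw [map_eq_zero] at h0
    rw [h0] at him
    simp at him
  have h1 : removedPoint a b f.re f.im g.re g.im t * (removedDen a b f.re f.im g.re g.im t : ℂ) =
      -2 * Complex.I * (1 + (t : ℂ) ^ 2) ^ 2 * N := by
    have : removedPoint a b f.re f.im g.re g.im t = ((removedNumX a b f.re f.im g.re g.im t : ℝ) +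
        (removedNumY a b f.re f.im g.re g.im t / 2 : ℝ) * Complex.I) /
          (removedDen a b f.re f.im g.re g.im t : ℂ) := by
      apply Complex.ext <;> simp [removedPoint]
    rw [this, div_mul_cancel₀ _ (by exact_mod_cast hden), hX, hY]
    conv_rhs => rw [← Complex.re_add_im N]
    push_cast
    linear_combination 2 * (1 + (t : ℂ) ^ 2) ^ 2 * N.im * Complex.I_sq
  have hsub : w - conj w = 2 * Complex.I * w.im := by
    rw [Complex.sub_conj]; push_cast; ring
  have h2 : (u * l - 1) * conj w = 2 * Complex.I * w.im := by
    linear_combination hsub - hw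
  have h3 : (α * (u * l) + β) * conj w = N := by
    rw [hN]; linear_combination -α * hw
  have hpq0 : (((a + b) / 2 : ℝ) : ℂ) * ((a - b) / 2 : ℝ) ≠ 0 := by
    have : a - b ≠ 0 := sub_ne_zero.2 hab
    have : a + b ≠ 0 := by positivity
    norm_cast
    positivity
  have hul : u * l - 1 ≠ 0 := by
    intro h0
    rw [h0, zero_mul] at h2
    exact mul_ne_zero (mul_ne_zero two_ne_zero Complex.I_ne_zero) (by exact_mod_cast him) h2.symm
  have hdenC : (removedDen a b f.re f.im g.re g.im t : ℂ) ≠ 0 := by exact_mod_cast hden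
  rw [eq_div_iff (mul_ne_zero hpq0 hul)]
  apply mul_right_cancel₀ (mul_ne_zero hdenC hcw)
  rw [hD] at h1 ⊢
  push_cast at h1 ⊢
  linear_combination ((a + b) / 2 * ((a - b) / 2) * (u * l - 1) * conj w) * h1 +
    (-2 * Complex.I * (1 + (t : ℂ) ^ 2) ^ 2 * N * ((a + b) / 2 * ((a - b) / 2))) * h2 -
    ((a - b) * (a + b) * (1 + (t : ℂ) ^ 2) ^ 2 * w.im) * h3 -
    (a - b) * (a + b) * (1 + (t : ℂ) ^ 2) ^ 2 * N * w.im * Complex.I_sq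

/-! ### Foci of an ellipse. -/

lemma AreFoci.symm {f g : ℂ} {K : Set ℂ} (h : AreFoci f g K) : AreFoci g f K := by
  obtain ⟨m, hm, rfl⟩ := h
  exact ⟨m, by rwa [dist_comm], by simp only [add_comm]⟩

/-- A focus is a convex combination of the two ends of the major axis, which lie on K. -/
lemma AreFoci.norm_lt_one {f g : ℂ} {K : Set ℂ} (h : AreFoci f g K)
    (hK : ∀ z ∈ K, ‖z‖ < 1) : ‖f‖ < 1 := by
  obtain ⟨m, hm, rfl⟩ := h
  -- The unit direction of the major axis, arbitrary for a circle.
  obtain ⟨e, he, hfg⟩ : ∃ e : ℂ, ‖e‖ = 1 ∧ f - g = (‖f - g‖ : ℂ) * e := by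
    by_cases h : f - g = 0
    · exact ⟨1, by simp, by simp [h]⟩
    · have : (‖f - g‖ : ℂ) ≠ 0 := by simpa using h
      refine ⟨(f - g) / (‖f - g‖ : ℂ), ?_, by field_simp⟩
      rw [norm_div, Complex.norm_real, norm_norm, div_self (norm_ne_zero_iff.2 h)]
  rw [dist_eq_norm] at hm
  set d := ‖f - g‖ with hd
  have d0 : 0 ≤ d := norm_nonneg _
  have hn (r : ℝ) : ‖(r : ℂ) * e‖ = |r| := by
    rw [norm_mul, he, mul_one, Complex.norm_real, Real.norm_eq_abs]
  have h1 : ‖(f + g) / 2 + m * e‖ < 1 := by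
    apply hK
    rw [Set.mem_ofPred_eq, dist_eq_norm, dist_eq_norm,
      show (f + g) / 2 + m * e - f = ((m - d / 2 : ℝ) : ℂ) * e by
        push_cast; linear_combination -hfg / 2,
      show (f + g) / 2 + m * e - g = ((m + d / 2 : ℝ) : ℂ) * e by
        push_cast; linear_combination hfg / 2, hn, hn, abs_of_pos (by linarith),
      abs_of_pos (by linarith)]
    ring
  have h2 : ‖(f + g) / 2 - m * e‖ < 1 := by
    apply hK
    rw [Set.mem_ofPred_eq, dist_eq_norm, dist_eq_norm,
      show (f + g) / 2 - m * e - f = ((-(m + d / 2) : ℝ) : ℂ) * e by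
        push_cast; linear_combination -hfg / 2,
      show (f + g) / 2 - m * e - g = ((-(m - d / 2) : ℝ) : ℂ) * e by
        push_cast; linear_combination hfg / 2, hn, hn, abs_neg, abs_neg, abs_of_pos (by linarith),
      abs_of_pos (by linarith)]
    ring
  have h3 : ((2 * m : ℝ) : ℂ) * f = ((m + d / 2 : ℝ) : ℂ) * ((f + g) / 2 + m * e) +
      ((m - d / 2 : ℝ) : ℂ) * ((f + g) / 2 - m * e) := by
    push_cast; linear_combination m * hfg
  have h4 := congrArg norm h3
  have h5 := norm_add_le (((m + d / 2 : ℝ) : ℂ) * ((f + g) / 2 + m * e))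
    (((m - d / 2 : ℝ) : ℂ) * ((f + g) / 2 - m * e))
  rw [← h4, norm_mul, norm_mul, norm_mul, Complex.norm_real, Complex.norm_real, Complex.norm_real,
    Real.norm_eq_abs, Real.norm_eq_abs, Real.norm_eq_abs, abs_of_pos (by linarith),
    abs_of_pos (by linarith), abs_of_pos (by linarith)] at h5
  nlinarith [mul_pos (by linarith : 0 < m + d / 2) (sub_pos.2 h1),
    mul_pos (by linarith : 0 < m - d / 2) (sub_pos.2 h2)]

/-- If the affine map is z ↦ r²z + s²z̄ + c, the image of the circle has foci c ± 2rs and semi-major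
axis |r|² + |s|²; invertibility means |r| ≠ |s|. -/
lemma IsEllipse.exists_areFoci {K : Set ℂ} (hK : IsEllipse K) : ∃ f g, AreFoci f g K := by
  obtain ⟨T, rfl⟩ := hK
  set c := T 0 with hc
  obtain ⟨r, hr⟩ := IsAlgClosed.exists_eq_mul_self ((T.linear 1 - Complex.I * T.linear Complex.I) / 2)
  obtain ⟨s, hs⟩ := IsAlgClosed.exists_eq_mul_self ((T.linear 1 + Complex.I * T.linear Complex.I) / 2)
  have hL (z : ℂ) : T.linear z = r * r * z + s * s * conj z := by
    have h1 : T.linear z = z.re * T.linear 1 + z.im * T.linear Complex.I := by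
      rw [← Complex.real_smul, ← Complex.real_smul, ← map_smul, ← map_smul, ← map_add]
      congr 1
      simp [Complex.real_smul, Complex.re_add_im]
    rw [h1, ← hr, ← hs]
    have h2 := Complex.re_add_im z
    have h3 : conj z = z.re - z.im * Complex.I := by
      apply Complex.ext <;> simp
    rw [h3]
    conv_rhs => rw [← h2]
    simp only [Complex.add_re, Complex.add_im, Complex.ofReal_re, Complex.ofReal_im,
      Complex.mul_re, Complex.mul_im, Complex.I_re, Complex.I_im]
    ring_nf
    simp only [Complex.I_sq]
    ring
  have hT (z : ℂ) : T z = r * r * z + s * s * conj z + c := by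
    have := T.map_vadd 0 z
    rw [vadd_eq_add, add_zero, vadd_eq_add] at this
    rw [this, hL]
  have hrs : Complex.normSq r ≠ Complex.normSq s := by
    intro h
    have hrr : r * conj r = s * conj s := by rw [Complex.mul_conj, Complex.mul_conj, h]
    have h0 (z : ℂ) (hz : r * r * z + s * s * conj z = 0) : z = 0 := by
      rw [← hL] at hz
      exact (LinearEquiv.map_eq_zero_iff _).1 hz
    -- If |r| = |s|, this vector lies in the kernel of the linear part.
    have h1 : Complex.I * s * conj r = 0 := by
      apply h0
      simp only [map_mul, Complex.conj_conj, Complex.conj_I]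
      linear_combination Complex.I * r * s * hrr
    have h2 : s = 0 ∨ r = 0 := by simpa using h1
    have h3 : r = 0 ∧ s = 0 := by
      rcases h2 with h2 | h2
      · rw [h2, map_zero, Complex.normSq_eq_zero] at h
        exact ⟨h, h2⟩
      · rw [h2, map_zero, eq_comm, Complex.normSq_eq_zero] at h
        exact ⟨h2, h⟩
    have := h0 1 (by rw [h3.1, h3.2]; ring)
    exact one_ne_zero this
  set m := Complex.normSq r + Complex.normSq s with hm
  have hm0 : 0 < m := by
    rcases (Complex.normSq_nonneg r).eq_or_lt with h | h
    · have : 0 < Complex.normSq s := lt_of_le_of_ne (Complex.normSq_nonneg s) (by rw [h]; exact hrs)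
      linarith
    · linarith [Complex.normSq_nonneg s]
  have hdist : dist (c + 2 * r * s) (c - 2 * r * s) < 2 * m := by
    rw [dist_eq_norm, show c + 2 * r * s - (c - 2 * r * s) = 4 * (r * s) by ring, norm_mul,
      norm_mul, hm, Complex.normSq_eq_norm_sq, Complex.normSq_eq_norm_sq, Complex.norm_ofNat]
    have : ‖r‖ - ‖s‖ ≠ 0 := by
      intro h
      apply hrs
      rw [Complex.normSq_eq_norm_sq, Complex.normSq_eq_norm_sq, sub_eq_zero.1 h]
    have := sq_pos_of_ne_zero this
    nlinarith
  refine ⟨c + 2 * r * s, c - 2 * r * s, m, hdist, ?_⟩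
  ext X
  obtain ⟨z, rfl⟩ := T.surjective X
  rw [T.injective.mem_set_image, mem_sphere_zero_iff_norm, Set.mem_ofPred_eq,
    dist_add_dist_eq_iff hdist, hT]
  have key : (4 * m ^ 2 + Complex.normSq (r * r * z + s * s * conj z + c - (c + 2 * r * s)) -
      Complex.normSq (r * r * z + s * s * conj z + c - (c - 2 * r * s))) ^ 2 - 16 * m ^ 2 *
      Complex.normSq (r * r * z + s * s * conj z + c - (c + 2 * r * s)) =
      16 * m ^ 2 * (Complex.normSq r - Complex.normSq s) ^ 2 * (1 - Complex.normSq z) := by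
    simp only [hm, Complex.normSq_apply, Complex.sub_re, Complex.sub_im, Complex.mul_re,
      Complex.mul_im, Complex.conj_re, Complex.conj_im, Complex.add_re, Complex.add_im,
      Complex.re_ofNat, Complex.im_ofNat]
    ring
  have hk : 16 * m ^ 2 * (Complex.normSq r - Complex.normSq s) ^ 2 ≠ 0 := by
    have := sub_ne_zero.2 hrs
    positivity
  rw [eq_comm (b := (_ : ℝ) ^ 2), ← sub_eq_zero (a := (_ : ℝ) ^ 2), key, mul_eq_zero,
    or_iff_right hk, sub_eq_zero, Complex.normSq_eq_norm_sq]
  exact ⟨fun h => by rw [h]; norm_num, fun h =>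
    (sq_eq_sq₀ (norm_nonneg z) zero_le_one).1 (by rw [← h]; norm_num)⟩

end

/-! ### Transfer to the given ellipse and computation of the locus. -/

section

variable {a b : ℝ}

lemma scaleMap_unscaleMap (ha : a ≠ 0) (hb : b ≠ 0) (z : ℂ) :
    scaleMap a b (unscaleMap a b z) = z := by
  apply Complex.ext <;> simp only [scaleMap, unscaleMap] <;> field_simp

lemma unscaleMap_scaleMap (ha : a ≠ 0) (hb : b ≠ 0) (z : ℂ) :
    unscaleMap a b (scaleMap a b z) = z := by
  apply Complex.ext <;> simp only [scaleMap, unscaleMap] <;> field_simp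

/-- `scaleMap a b` as an affine equivalence. -/
def scaleEquiv (ha : a ≠ 0) (hb : b ≠ 0) : ℂ ≃ᵃ[ℝ] ℂ :=
  LinearEquiv.toAffineEquiv
    { toFun := scaleMap a b
      invFun := unscaleMap a b
      left_inv := unscaleMap_scaleMap ha hb
      right_inv := scaleMap_unscaleMap ha hb
      map_add' := fun z w => by apply Complex.ext <;> simp [scaleMap, mul_add]
      map_smul' := fun r z => by apply Complex.ext <;> simp [scaleMap, mul_left_comm] }

lemma scaleEquiv_apply (ha : a ≠ 0) (hb : b ≠ 0) (z : ℂ) :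
    scaleEquiv ha hb z = scaleMap a b z := rfl

lemma scaleEquiv_symm_apply (ha : a ≠ 0) (hb : b ≠ 0) (z : ℂ) :
    (scaleEquiv ha hb).symm z = unscaleMap a b z := rfl

lemma scaleMap_eq_aff (a b : ℝ) (z : ℂ) : scaleMap a b z = aff ((a + b) / 2) ((a - b) / 2) z := by
  apply Complex.ext <;> simp only [scaleMap, aff, Complex.add_re, Complex.add_im, Complex.mul_re,
    Complex.mul_im, Complex.conj_re, Complex.conj_im, Complex.ofReal_re, Complex.ofReal_im] <;> ring

lemma IsEllipse.unscaleMap_image (ha : a ≠ 0) (hb : b ≠ 0) {K : Set ℂ} (hK : IsEllipse K) :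
    IsEllipse (unscaleMap a b '' K) := by
  obtain ⟨T, rfl⟩ := hK
  refine ⟨T.trans (scaleEquiv ha hb).symm, ?_⟩
  rw [Set.image_image]
  rfl

lemma mem_axisEllipse_iff {z : ℂ} : z ∈ axisEllipse a b ↔ ‖unscaleMap a b z‖ = 1 := by
  rw [axisEllipse, Set.mem_ofPred_eq, ← sq_eq_sq₀ (norm_nonneg _) zero_le_one,
    ← Complex.normSq_eq_norm_sq, Complex.normSq_apply, unscaleMap, one_pow, sq, sq]

lemma norm_unscaleMap_lt_one {z : ℂ} (hz : z ∈ axisEllipseInterior a b) :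
    ‖unscaleMap a b z‖ < 1 := by
  rw [axisEllipseInterior, Set.mem_ofPred_eq] at hz
  rw [← sq_lt_sq₀ (norm_nonneg _) zero_le_one, ← Complex.normSq_eq_norm_sq, Complex.normSq_apply,
    unscaleMap, one_pow]
  linarith

lemma sideTangent_image (e : ℂ ≃ᵃ[ℝ] ℂ) {K : Set ℂ} {A B : ℂ} (h : SideTangent K A B) :
    SideTangent (e '' K) (e A) (e B) := by
  have hl : (line[ℝ, e A, e B] : Set ℂ) = e '' (line[ℝ, A, B] : Set ℂ) := by
    have := AffineSubspace.map_span e.toAffineMap {A, B}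
    rw [Set.image_pair] at this
    exact (congrArg (fun s : AffineSubspace ℝ ℂ => (s : Set ℂ)) this).symm
  obtain ⟨X, ⟨hX, hX'⟩, hu⟩ := h
  refine ⟨e X, ⟨?_, Set.mem_image_of_mem _ hX'⟩, ?_⟩
  · rw [← SetLike.mem_coe, hl]; exact Set.mem_image_of_mem _ hX
  · rintro Y ⟨hY, Z, hZ, rfl⟩
    rw [← SetLike.mem_coe, hl] at hY
    rw [hu Z ⟨(e.injective.mem_set_image).1 hY, hZ⟩]

lemma sideTangent_unscaleMap_iff (ha : a ≠ 0) (hb : b ≠ 0) {K : Set ℂ} {z w : ℂ} :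
    SideTangent K (scaleMap a b z) (scaleMap a b w) ↔ SideTangent (unscaleMap a b '' K) z w := by
  constructor
  · intro h
    have := sideTangent_image (scaleEquiv ha hb).symm h
    rw [scaleEquiv_symm_apply, scaleEquiv_symm_apply, unscaleMap_scaleMap ha hb,
      unscaleMap_scaleMap ha hb] at this
    exact this
  · intro h
    have := sideTangent_image (scaleEquiv ha hb) h
    rw [Set.image_image] at this
    simpa only [scaleEquiv_apply, scaleMap_unscaleMap ha hb, Set.image_id'] using this

lemma affineIndependent_scaleMap (ha : a ≠ 0) (hb : b ≠ 0) {x y z : ℂ} (hx : ‖x‖ = 1)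
    (hy : ‖y‖ = 1) (hz : ‖z‖ = 1) (hxy : x ≠ y) (hxz : x ≠ z) (hyz : y ≠ z) :
    AffineIndependent ℝ ![scaleMap a b x, scaleMap a b y, scaleMap a b z] := by
  have h1 : AffineIndependent ℝ ![x, y, z] := by
    apply EuclideanGeometry.Cospherical.affineIndependent_of_ne _ hxy hxz hyz
    refine ⟨0, 1, ?_⟩
    rintro p (rfl | rfl | rfl) <;> simpa
  have h2 := ((scaleEquiv ha hb).affineIndependent_iff).2 h1
  convert h2 using 1
  ext i
  fin_cases i <;> rfl

/-- Poncelet triangles in the coordinates in which the outer ellipse is the unit circle. -/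
lemma isPonceletTriangle_scaleMap_iff (ha : a ≠ 0) (hb : b ≠ 0) {K : Set ℂ} {x y z : ℂ} :
    IsPonceletTriangle a b K (scaleMap a b x) (scaleMap a b y) (scaleMap a b z) ↔
      (‖x‖ = 1 ∧ ‖y‖ = 1 ∧ ‖z‖ = 1) ∧ (x ≠ y ∧ y ≠ z ∧ z ≠ x) ∧
        SideTangent (unscaleMap a b '' K) x y ∧ SideTangent (unscaleMap a b '' K) y z ∧
          SideTangent (unscaleMap a b '' K) z x := by
  constructor
  · intro h
    obtain ⟨h1, h2, h3, h4, h5, h6, h7⟩ := h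
    rw [mem_axisEllipse_iff, unscaleMap_scaleMap ha hb] at h2 h3 h4
    rw [sideTangent_unscaleMap_iff ha hb] at h5 h6 h7
    refine ⟨⟨h2, h3, h4⟩, ⟨?_, ?_, ?_⟩, h5, h6, h7⟩
    · rintro rfl
      exact absurd (h1.injective (a₁ := 0) (a₂ := 1) rfl) (by decide)
    · rintro rfl
      exact absurd (h1.injective (a₁ := 1) (a₂ := 2) rfl) (by decide)
    · rintro rfl
      exact absurd (h1.injective (a₁ := 0) (a₂ := 2) rfl) (by decide)
  · rintro ⟨⟨h2, h3, h4⟩, ⟨n1, n2, n3⟩, h5, h6, h7⟩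
    refine ⟨affineIndependent_scaleMap ha hb h2 h3 h4 n1 n3.symm n2, ?_, ?_, ?_,
      (sideTangent_unscaleMap_iff ha hb).2 h5, (sideTangent_unscaleMap_iff ha hb).2 h6,
      (sideTangent_unscaleMap_iff ha hb).2 h7⟩ <;>
    rwa [mem_axisEllipse_iff, unscaleMap_scaleMap ha hb]

/-- This contains the porism: a single closing triangle forces the squared minor axis to be
(1-|f|²)(1-|g|²), and for that value every Blaschke triple on the circle is circumscribed. -/
lemma isPonceletTriangle_iff_blaschkeTriple (ha : a ≠ 0) (hb : b ≠ 0) {K : Set ℂ} {f g : ℂ}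
    (hf : ‖f‖ < 1) (hg : ‖g‖ < 1) (hfoci : AreFoci f g (unscaleMap a b '' K))
    (hclose : ∃ A B C : ℂ, IsPonceletTriangle a b K A B C) {x y z : ℂ} :
    IsPonceletTriangle a b K (scaleMap a b x) (scaleMap a b y) (scaleMap a b z) ↔
      (‖x‖ = 1 ∧ ‖y‖ = 1 ∧ ‖z‖ = 1) ∧ BlaschkeTriple f g (x * y * z) x y z := by
  obtain ⟨m, hm, hK⟩ := hfoci
  have tang {z w : ℂ} (hz : ‖z‖ = 1) (hw : ‖w‖ = 1) (hzw : z ≠ w) :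
      SideTangent (unscaleMap a b '' K) z w ↔
        ChordTangent f g ((4 * m ^ 2 - Complex.normSq (f - g) : ℝ) : ℂ) z w := by
    rw [hK]; exact sideTangent_iff_chordTangent hm hzw hz hw
  have fwd {x y z : ℂ}
      (h : IsPonceletTriangle a b K (scaleMap a b x) (scaleMap a b y) (scaleMap a b z)) :
      (‖x‖ = 1 ∧ ‖y‖ = 1 ∧ ‖z‖ = 1) ∧ BlaschkeTriple f g (x * y * z) x y z ∧
        ((4 * m ^ 2 - Complex.normSq (f - g) : ℝ) : ℂ) =
          (1 - f * conj f) * (1 - g * conj g) := by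
    obtain ⟨⟨h1, h2, h3⟩, ⟨n1, n2, n3⟩, t1, t2, t3⟩ := (isPonceletTriangle_scaleMap_iff ha hb).1 h
    rw [tang h1 h2 n1] at t1
    rw [tang h2 h3 n2] at t2
    rw [tang h3 h1 n3] at t3
    exact ⟨⟨h1, h2, h3⟩, blaschkeTriple_of_chordTangent n1 n2 n3 (ne_zero_of_norm h1)
      (ne_zero_of_norm h2) t1 t2 t3⟩
  have hk : ((4 * m ^ 2 - Complex.normSq (f - g) : ℝ) : ℂ) =
      (1 - f * conj f) * (1 - g * conj g) := by
    obtain ⟨A, B, C, h⟩ := hclose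
    rw [← scaleMap_unscaleMap ha hb A, ← scaleMap_unscaleMap ha hb B,
      ← scaleMap_unscaleMap ha hb C] at h
    exact (fwd h).2.2
  refine ⟨fun h => ⟨(fwd h).1, (fwd h).2.1⟩, ?_⟩
  rintro ⟨⟨h1, h2, h3⟩, hB⟩
  have n1 := hB.ne hf hg h1
  have n2 := hB.rotate.ne hf hg h2
  have n3 := hB.rotate.rotate.ne hf hg h3
  rw [isPonceletTriangle_scaleMap_iff ha hb, tang h1 h2 n1, tang h2 h3 n2, tang h3 h1 n3, hk]
  exact ⟨⟨h1, h2, h3⟩, ⟨n1, n2, n3⟩, hB.chordTangent, hB.rotate.chordTangent,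
    hB.rotate.rotate.chordTangent⟩

lemma BlaschkeTriple.norm_eq_one {f g l x y z : ℂ} (hB : BlaschkeTriple f g l x y z)
    (hf : ‖f‖ < 1) (hg : ‖g‖ < 1) (hl : ‖l‖ = 1) : ‖x‖ = 1 ∧ ‖y‖ = 1 ∧ ‖z‖ = 1 :=
  ⟨norm_eq_one_of_blaschke hf hg hl hB.blaschke,
    norm_eq_one_of_blaschke hf hg hl hB.rotate.blaschke,
    norm_eq_one_of_blaschke hf hg hl hB.rotate.rotate.blaschke⟩

/-- Every point of the unit circle is a vertex of a Poncelet triangle. -/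
lemma exists_blaschkeTriple_of_norm {f g u : ℂ} (hf : ‖f‖ < 1) (hg : ‖g‖ < 1) (hu : ‖u‖ = 1) :
    ∃ l z w, ‖l‖ = 1 ∧ BlaschkeTriple f g l u z w := by
  have h1 := one_sub_conj_mul_ne_zero hf hu.le
  have h2 := one_sub_conj_mul_ne_zero hg hu.le
  -- The only parameter for which `u` solves the equation; it is unimodular since 1 - f̄u = u ·
  -- conj(u-f) on the circle.
  set l := u * (u - f) * (u - g) / ((1 - conj f * u) * (1 - conj g * u)) with hl
  obtain ⟨z, w, h⟩ := exists_blaschkeTriple_of_blaschke (f := f) (g := g) (l := l) (z₁ := u)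
    (by rw [hl, div_mul_cancel₀ _ (mul_ne_zero h1 h2)])
  refine ⟨l, z, w, ?_, h⟩
  rw [hl, one_sub_conj_mul_mul_eq f g u hu, mul_assoc, norm_div, norm_mul,
    norm_mul (u ^ 2), norm_pow, hu, Complex.norm_conj, one_pow, div_self]
  rw [one_mul, norm_ne_zero_iff]
  exact mul_ne_zero (sub_ne_zero_of_norm hf hu.ge) (sub_ne_zero_of_norm hg hu.ge)

lemma BlaschkeTriple.eq_of_common_vertex {f g l l' u z w z' w' : ℂ}
    (hB : BlaschkeTriple f g l u z w) (hB' : BlaschkeTriple f g l' u z' w') (hf : ‖f‖ < 1)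
    (hg : ‖g‖ < 1) (hu : ‖u‖ = 1) : l = l' :=
  mul_right_cancel₀ (mul_ne_zero (one_sub_conj_mul_ne_zero hf hu.le)
    (one_sub_conj_mul_ne_zero hg hu.le)) (hB.blaschke.symm.trans hB'.blaschke)

lemma BlaschkeTriple.mem_of_common_parameter {f g l u z w x y v : ℂ}
    (hB : BlaschkeTriple f g l u z w) (hB' : BlaschkeTriple f g l x y v) :
    u = x ∨ u = y ∨ u = v := by
  have : (u - x) * ((u - y) * (u - v)) = 0 := by
    linear_combination hB.blaschke - u ^ 2 * hB'.sum + u * hB'.sum_mul - hB'.prod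
  simpa only [mul_eq_zero, sub_eq_zero] using this

lemma abs_half_sub_lt (ha : 0 < a) (hb : 0 < b) : |(a - b) / 2| < (a + b) / 2 := by
  rw [abs_lt]
  constructor <;> linarith

lemma half_sub_ne_zero (hab : a ≠ b) : (a - b) / 2 ≠ 0 :=
  div_ne_zero (sub_ne_zero.2 hab) two_ne_zero

/-- P is a vertex exactly for the parameter `l₀`, and every other unimodular parameter except the
pole contributes one point. -/
lemma isogonalLocus_eq (ha : 0 < a) (hb : 0 < b) (hab : a ≠ b) {K : Set ℂ} {f g u l₀ z w : ℂ}
    (hf : ‖f‖ < 1) (hg : ‖g‖ < 1) (hfoci : AreFoci f g (unscaleMap a b '' K))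
    (hclose : ∃ A B C : ℂ, IsPonceletTriangle a b K A B C) (hu : ‖u‖ = 1)
    (hB : BlaschkeTriple f g l₀ u z w) :
    isogonalLocus a b K (scaleMap a b u) = {X | ∃ l : ℂ, ‖l‖ = 1 ∧ l ≠ l₀ ∧ u * l ≠ 1 ∧
      X = locusPoint ((a + b) / 2) ((a - b) / 2) f g u l} := by
  have hpq := abs_half_sub_lt ha hb
  have hq := half_sub_ne_zero hab
  ext X
  rw [isogonalLocus, Set.mem_ofPred_eq, Set.mem_ofPred_eq]
  constructor
  · rintro ⟨A, B, C, hT, hI⟩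
    obtain ⟨x, rfl⟩ : ∃ x, scaleMap a b x = A := ⟨_, scaleMap_unscaleMap ha.ne' hb.ne' A⟩
    obtain ⟨y, rfl⟩ : ∃ x, scaleMap a b x = B := ⟨_, scaleMap_unscaleMap ha.ne' hb.ne' B⟩
    obtain ⟨v, rfl⟩ : ∃ x, scaleMap a b x = C := ⟨_, scaleMap_unscaleMap ha.ne' hb.ne' C⟩
    obtain ⟨⟨h1, h2, h3⟩, hB'⟩ :=
      (isPonceletTriangle_iff_blaschkeTriple ha.ne' hb.ne' hf hg hfoci hclose).1 hT
    have hux : u ≠ x := fun h => hI.ne_A (by rw [h])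
    have huy : u ≠ y := fun h => hI.ne_B (by rw [h])
    have huv : u ≠ v := fun h => hI.ne_C (by rw [h])
    simp only [scaleMap_eq_aff] at hI
    have := (isIsogonalConjugate_aff_iff hpq hq hu h1 h2 h3 (hB'.ne hf hg h1)
      (hB'.rotate.ne hf hg h2) (hB'.rotate.rotate.ne hf hg h3) hux huy huv hB').1 hI
    refine ⟨x * y * v, by rw [norm_mul, norm_mul, h1, h2, h3]; norm_num, ?_, this⟩
    intro hl
    rw [hl] at hB'
    rcases hB.mem_of_common_parameter hB' with h | h | h <;> contradiction
  · rintro ⟨l, hl, hl₀, hul, hX⟩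
    obtain ⟨x, y, v, hB'⟩ := exists_blaschkeTriple f g l
    obtain ⟨h1, h2, h3⟩ := hB'.norm_eq_one hf hg hl
    have hux : u ≠ x := by
      rintro rfl; exact hl₀ (hB'.eq_of_common_vertex hB hf hg hu)
    have huy : u ≠ y := by
      rintro rfl; exact hl₀ (hB'.rotate.eq_of_common_vertex hB hf hg hu)
    have huv : u ≠ v := by
      rintro rfl; exact hl₀ (hB'.rotate.rotate.eq_of_common_vertex hB hf hg hu)
    refine ⟨scaleMap a b x, scaleMap a b y, scaleMap a b v,
      (isPonceletTriangle_iff_blaschkeTriple ha.ne' hb.ne' hf hg hfoci hclose).2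
        ⟨⟨h1, h2, h3⟩, by rw [hB'.prod]; exact hB'⟩, ?_⟩
    simp only [scaleMap_eq_aff]
    exact (isIsogonalConjugate_aff_iff hpq hq hu h1 h2 h3 (hB'.ne hf hg h1)
      (hB'.rotate.ne hf hg h2) (hB'.rotate.rotate.ne hf hg h3) hux huy huv hB').2 ⟨hul, hX⟩

/-- The locus of isogonal conjugates is `locusLine` without the point on the opposite side. -/
lemma isogonalLocus_locusLine (ha : 0 < a) (hb : 0 < b) (hab : a ≠ b) {K : Set ℂ} {f g u : ℂ}
    (hf : ‖f‖ < 1) (hg : ‖g‖ < 1) (hfoci : AreFoci f g (unscaleMap a b '' K))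
    (hclose : ∃ A B C : ℂ, IsPonceletTriangle a b K A B C) {B C : ℂ}
    (hT : IsPonceletTriangle a b K (scaleMap a b u) B C) :
    (((u - f) * (u - g)).im ≠ 0 → ∃ l,
      u * (u - f) * (u - g) = l * ((1 - conj f * u) * (1 - conj g * u)) ∧
      locusLine ((a + b) / 2) ((a - b) / 2) f g u ∩ (line[ℝ, B, C] : Set ℂ) =
        {locusPoint ((a + b) / 2) ((a - b) / 2) f g u l} ∧
      isogonalLocus a b K (scaleMap a b u) = locusLine ((a + b) / 2) ((a - b) / 2) f g u \
        {locusPoint ((a + b) / 2) ((a - b) / 2) f g u l}) ∧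
    (((u - f) * (u - g)).im = 0 →
      locusLine ((a + b) / 2) ((a - b) / 2) f g u ∩ (line[ℝ, B, C] : Set ℂ) = ∅ ∧
      isogonalLocus a b K (scaleMap a b u) = locusLine ((a + b) / 2) ((a - b) / 2) f g u) := by
  have hpq := abs_half_sub_lt ha hb
  have hq := half_sub_ne_zero hab
  obtain ⟨z, rfl⟩ : ∃ x, scaleMap a b x = B := ⟨_, scaleMap_unscaleMap ha.ne' hb.ne' B⟩
  obtain ⟨w, rfl⟩ : ∃ x, scaleMap a b x = C := ⟨_, scaleMap_unscaleMap ha.ne' hb.ne' C⟩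
  obtain ⟨⟨hu, hz, hw⟩, hB⟩ :=
    (isPonceletTriangle_iff_blaschkeTriple ha.ne' hb.ne' hf hg hfoci hclose).1 hT
  have hzw := hB.rotate.ne hf hg hz
  rw [isogonalLocus_eq ha hb hab hf hg hfoci hclose hu hB, scaleMap_eq_aff, scaleMap_eq_aff]
  have hl₀ : ‖u * z * w‖ = 1 := by rw [norm_mul, norm_mul, hu, hz, hw]; norm_num
  generalize u * z * w = l₀ at *
  -- The sign condition decides whether the omitted parameter `l₀` is the pole, which is absent from
  -- the line's parametrization anyway.
  have hone := mul_eq_one_iff_of_blaschke hf hg hu hB.blaschke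
  have hmem {l : ℂ} (hl : ‖l‖ = 1) (hul : u * l ≠ 1) :=
    locusPoint_mem_line_iff hpq hq hf hg hu hl hz hw hzw hul hB
  simp only [ne_eq, ← hone]
  refine ⟨fun hul₀ => ⟨l₀, hB.blaschke, ?_, ?_⟩, fun hul₀ => ⟨?_, ?_⟩⟩
  · ext X
    constructor
    · rintro ⟨⟨l, hl, hul, rfl⟩, hX⟩
      rw [(hmem hl hul).1 hX]
      rfl
    · rintro rfl
      exact ⟨⟨l₀, hl₀, hul₀, rfl⟩, (hmem hl₀ hul₀).2 rfl⟩
  · ext X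
    constructor
    · rintro ⟨l, hl, hne, hul, rfl⟩
      refine ⟨⟨l, hl, hul, rfl⟩, fun h => hne ((hmem hl hul).1 ?_)⟩
      rw [Set.mem_singleton_iff] at h
      rw [h]
      exact (hmem hl₀ hul₀).2 rfl
    · rintro ⟨⟨l, hl, hul, rfl⟩, hX⟩
      exact ⟨l, hl, fun h => hX (by rw [h]; rfl), hul, rfl⟩
  · rw [Set.eq_empty_iff_forall_notMem]
    rintro X ⟨⟨l, hl, hul, rfl⟩, hX⟩
    rw [(hmem hl hul).1 hX] at hul
    exact hul hul₀
  · ext X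
    constructor
    · rintro ⟨l, hl, -, hul, rfl⟩
      exact ⟨l, hl, hul, rfl⟩
    · rintro ⟨l, hl, hul, rfl⟩
      exact ⟨l, hl, fun h => hul (by rw [h]; exact hul₀), hul, rfl⟩

lemma isLine_locusLine (ha : 0 < a) (hb : 0 < b) (hab : a ≠ b) {f g u : ℂ} (hf : ‖f‖ < 1)
    (hg : ‖g‖ < 1) (hu : ‖u‖ = 1) : IsLine (locusLine ((a + b) / 2) ((a - b) / 2) f g u) := by
  have hpq := abs_half_sub_lt ha hb
  have hq := half_sub_ne_zero hab
  refine ⟨_, _, ?_, locusLine_eq hpq hq hu⟩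
  simpa using locusDir_ne_zero hpq hq hf hg hu

lemma ellipsePoint_eq (a b t : ℝ) : ellipsePoint a b t = scaleMap a b (circlePoint t) := rfl

lemma lineLocus_eq (ha : 0 < a) (hb : 0 < b) (hab : a ≠ b) {f g : ℂ} (hf : ‖f‖ < 1)
    (hg : ‖g‖ < 1) (t : ℝ) : lineLocus a b f.re f.im g.re g.im t =
      locusLine ((a + b) / 2) ((a - b) / 2) f g (circlePoint t) := by
  have hpq := abs_half_sub_lt ha hb
  have hq := half_sub_ne_zero hab
  have hu := norm_circlePoint t
  have hd := locusDir_ne_zero hpq hq hf hg hu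
  ext X
  rw [locusLine_eq hpq hq hu, mem_line_iff_conj (by simpa using hd), lineLocus, Set.mem_ofPred_eq,
    lineForm_eq, add_sub_cancel_left]
  have hp0 := left_ne_zero hpq
  have hq0 : (((a - b) / 2 : ℝ) : ℂ) ≠ 0 := by exact_mod_cast hq
  have hc : ((a ^ 2 - b ^ 2) / 2 : ℝ) = 2 * ((a + b) / 2) * ((a - b) / 2) := by ring
  rw [hc]
  simp only [locusBase, locusDir]
  generalize mobiusLead ((a + b) / 2) ((a - b) / 2) f g (circlePoint t) = α
  generalize mobiusConst ((a + b) / 2) ((a - b) / 2) f g (circlePoint t) = β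
  generalize (a + b) / 2 = p at *
  generalize (a - b) / 2 = q at *
  have ht : -16 * (1 + t ^ 2) ≠ 0 := by
    have : 0 < 1 + t ^ 2 := by positivity
    linarith
  rw [mul_eq_zero, or_iff_right ht, ← Complex.ofReal_inj, Complex.re_eq_add_conj]
  simp only [map_sub, map_add, map_mul, map_div₀, map_neg, Complex.conj_ofReal, Complex.conj_conj,
    Complex.conj_I, Complex.ofReal_mul, Complex.ofReal_ofNat, Complex.ofReal_zero, map_ofNat]
  have I0 := Complex.I_ne_zero
  -- The conjugation form of membership differs from the real-part form only by the nonzero factor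
  -- i/(2p²q²).
  have key : (X - (α - β) / (2 * p * q)) * (- -Complex.I * (conj α + conj β) / (2 * p * q)) -
      (conj X - (conj α - conj β) / (2 * p * q)) * (-Complex.I * (α + β) / (2 * p * q)) =
      ((2 * p * q * X - (α - β)) * (conj α + conj β) +
        (2 * p * q * conj X - (conj α - conj β)) * (α + β)) / 2 *
          (Complex.I / (2 * p ^ 2 * q ^ 2)) := by
    field_simp
    ring
  conv_rhs => rw [← sub_eq_zero, key, mul_eq_zero, or_iff_left (div_ne_zero I0
    (mul_ne_zero (mul_ne_zero two_ne_zero (pow_ne_zero _ hp0)) (pow_ne_zero _ hq0)))]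

end

end Poncelet

end

theorem mainTheorem7 (a b : ℝ) (ha : 0 < a) (hb : 0 < b) (hab : a ≠ b)
    (K : Set ℂ) (hK : Poncelet.IsEllipse K) (hnest : K ⊆ Poncelet.axisEllipseInterior a b)
    (hclose : ∃ A B C : ℂ, Poncelet.IsPonceletTriangle a b K A B C) :
    (∃ f g : ℂ, Poncelet.AreFoci f g (Poncelet.unscaleMap a b '' K)) ∧
    ∀ f g : ℂ, Poncelet.AreFoci f g (Poncelet.unscaleMap a b '' K) →
      (∀ P ∈ Poncelet.axisEllipse a b,
        (∃ B C : ℂ, Poncelet.IsPonceletTriangle a b K P B C) ∧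
        ∃ L : Set ℂ, Poncelet.IsLine L ∧
          ∀ B C : ℂ, Poncelet.IsPonceletTriangle a b K P B C →
            (((Poncelet.unscaleMap a b P - f) * (Poncelet.unscaleMap a b P - g)).im ≠ 0 →
              ∃ Q : ℂ, L ∩ (line[ℝ, B, C] : Set ℂ) = {Q} ∧
                Poncelet.isogonalLocus a b K P = L \ {Q}) ∧
            (((Poncelet.unscaleMap a b P - f) * (Poncelet.unscaleMap a b P - g)).im = 0 →
              L ∩ (line[ℝ, B, C] : Set ℂ) = ∅ ∧
                Poncelet.isogonalLocus a b K P = L)) ∧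
      (∀ t : ℝ,
        Poncelet.IsLine (Poncelet.lineLocus a b f.re f.im g.re g.im t) ∧
        ∀ B C : ℂ, Poncelet.IsPonceletTriangle a b K (Poncelet.ellipsePoint a b t) B C →
          (Poncelet.removedDen a b f.re f.im g.re g.im t ≠ 0 →
            Poncelet.lineLocus a b f.re f.im g.re g.im t ∩ (line[ℝ, B, C] : Set ℂ) =
              {Poncelet.removedPoint a b f.re f.im g.re g.im t} ∧
            Poncelet.isogonalLocus a b K (Poncelet.ellipsePoint a b t) =
              Poncelet.lineLocus a b f.re f.im g.re g.im t \
                {Poncelet.removedPoint a b f.re f.im g.re g.im t}) ∧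
          (Poncelet.removedDen a b f.re f.im g.re g.im t = 0 →
            Poncelet.lineLocus a b f.re f.im g.re g.im t ∩ (line[ℝ, B, C] : Set ℂ) = ∅ ∧
            Poncelet.isogonalLocus a b K (Poncelet.ellipsePoint a b t) =
              Poncelet.lineLocus a b f.re f.im g.re g.im t)) := by
  have hK' := hK.unscaleMap_image ha.ne' hb.ne'
  refine ⟨hK'.exists_areFoci, fun f g hfoci => ?_⟩
  have hdisc : ∀ z ∈ Poncelet.unscaleMap a b '' K, ‖z‖ < 1 := by
    rintro _ ⟨z, hz, rfl⟩
    exact Poncelet.norm_unscaleMap_lt_one (hnest hz)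
  have hf := hfoci.norm_lt_one hdisc
  have hg := hfoci.symm.norm_lt_one hdisc
  refine ⟨fun P hP => ?_, fun t => ?_⟩
  · obtain ⟨u, rfl⟩ : ∃ u, Poncelet.scaleMap a b u = P :=
      ⟨_, Poncelet.scaleMap_unscaleMap ha.ne' hb.ne' P⟩
    rw [Poncelet.mem_axisEllipse_iff, Poncelet.unscaleMap_scaleMap ha.ne' hb.ne'] at hP
    rw [Poncelet.unscaleMap_scaleMap ha.ne' hb.ne']
    constructor
    · obtain ⟨l, z, w, hl, hB⟩ := Poncelet.exists_blaschkeTriple_of_norm hf hg hP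
      exact ⟨_, _, (Poncelet.isPonceletTriangle_iff_blaschkeTriple ha.ne' hb.ne' hf hg hfoci
        hclose).2 ⟨hB.norm_eq_one hf hg hl, by rw [hB.prod]; exact hB⟩⟩
    · refine ⟨_, Poncelet.isLine_locusLine ha hb hab hf hg hP, fun B C hT => ?_⟩
      have h := Poncelet.isogonalLocus_locusLine ha hb hab hf hg hfoci hclose hT
      refine ⟨fun him => ?_, h.2⟩
      obtain ⟨l, -, h1, h2⟩ := h.1 him
      exact ⟨_, h1, h2⟩
  · rw [Poncelet.lineLocus_eq ha hb hab hf hg, Poncelet.ellipsePoint_eq]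
    refine ⟨Poncelet.isLine_locusLine ha hb hab hf hg (Poncelet.norm_circlePoint t),
      fun B C hT => ?_⟩
    have h := Poncelet.isogonalLocus_locusLine ha hb hab hf hg hfoci hclose hT
    have hden : Poncelet.removedDen a b f.re f.im g.re g.im t = 0 ↔
        ((Poncelet.circlePoint t - f) * (Poncelet.circlePoint t - g)).im = 0 := by
      have h1 : a - b ≠ 0 := sub_ne_zero.2 hab
      have h2 : a + b ≠ 0 := (add_pos ha hb).ne'
      have h3 : (1 + t ^ 2) ^ 2 ≠ 0 := by positivity
      rw [Poncelet.removedDen_eq, mul_eq_zero,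
        or_iff_right (mul_ne_zero (mul_ne_zero h1 h2) h3)]
    refine ⟨fun hne => ?_, fun h0 => h.2 (hden.1 h0)⟩
    have him := mt hden.2 hne
    obtain ⟨l, hl, h1, h2⟩ := h.1 him
    rw [Poncelet.removedPoint_eq ha hb hab hl him]
    exact ⟨h1, h2⟩
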